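/- **Setting.** Let $\mathcal X$ be a measurable space, $P$ a Markov kernel on $\mathcal X\times\mathbb R$, $\pi$ a stationary distribution of $P$, and $\mu:\mathcal X\to\mathbb R$ measurable. Write $\|p-q\|_{TV}=\sup_A|p(A)-q(A)|$ and $t_{\rm mix}=\min\{t:\sup_z\|P^t(z,\cdot)-\pi\|_{TV}\le 1/4\}$ (if $t_{\rm mix}=\infty$, exponents with $t_{\rm mix}$ in the denominator are $0$). Let $Z_i=(X_i,Y_i)$, $i\ge 1-N$, be a Markov chain with kernel $P$ and initial law $Z_{1-N}\sim\nu_0$; put $\delta(a)=\|\nu_0P^a-\pi\|_{TV}$ and, for $a\ge1$, $$\beta(a)=\sup_{t\ge 1-N}\big\|\mathcal L(Z_{1-N}^t)\otimes\mathcal L(Z_{t+a}^\infty)-\mathcal L(Z_{1-N}^t,Z_{t+a}^\infty)\big\|_{TV}.$$ The regressor $\hat\mu_N$ is a (jointly measurable) function of the training data $Z_{1-N},\dots,Z_0$. The calibration data are $Z_1,\dots,Z_n$, and $\hat q_{\alpha,n}$, for $0<\alpha<1$, is the $\lceil (n+1)(1-\alpha)\rceil$-th smallest of the scores $|Y_i-\hat\mu_N(X_i)|$,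 $1\le i\le n$ ($+\infty$ if this rank exceeds $n$). The $\alpha$ upper quantile of a law on $\mathbb R$ with distribution function $F$ is $\inf\{x:F(x)\ge1-\alpha\}$. For $(X,Y)\sim\pi$ independent of the training data, let $q_\alpha$ be the $\alpha$ upper quantile of $|Y-\mu(X)|$, let $\hat q_\alpha$ be that of $|Y-\hat\mu_N(X)|$ conditionally on the training data, and let $\bar q_\alpha$ be that of $|Y-\hat\mu_N(X)|$ when the training data are averaged over as well. **Assumptions.** (i) $\sup_x|\hat\mu_N(x)-\mu(x)|\le c_N$ with probability at least $1-d_N$. (ii) Under $\pi$, $|Y-\mu(X)|$ has a density $f$, and $f\ge\kappa>0$ on a neighbourhood $\mathcal N$ of $q_\alpha$. (iii) $u$ is a real number such that $\mathcal N$ contains every $x\ge0$ with $|x-q_\alpha|\le u/\kappa-2c_N$. **Conclusion.** 1. For every integer $1\le r\le n$, with $u'=u-2\kappa c_N-d_N-\frac{1+r\alpha}{n+1}$, if $u'>\delta(N)$ then $$|\hat q_{\alpha,n}-\hat q_\alpha|\le\frac u\kappa\quad\text{and}\quad|\hat q_{\alpha,n}-\bar q_\alpha|\le\frac u\kappa$$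 hold simultaneously with probability at least $$1-2\exp\Big(-\frac{2(n-r)(u'-\delta(N))^2}{9t_{\rm mix}}\Big)-d_N-\beta(r).$$ 2. (Restart.) Suppose instead that the calibration data $Z_1,\dots,Z_n$ are the first $n$ points of a Markov chain with kernel $P$ and initial law $Z_1\sim\nu_1$, independent of the training data. Put $\delta_1(a)=\|\nu_1P^a-\pi\|_{TV}$, $\bar\delta_1=\frac1n\sum_{i=0}^{n-1}\delta_1(i)$ and $u'=u-2\kappa c_N-d_N$. If $u'>\bar\delta_1$, then the same two inequalities hold simultaneously with probability at least $$1-2\exp\Big(-\frac{2n(u'-\bar\delta_1)^2}{9t_{\rm mix}}\Big)-d_N.$$ -/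

import Mathlib

open MeasureTheory ProbabilityTheory Set Filter Topology

noncomputable section

namespace ConformalMarkov

/-- Total variation distance `sup_A |P(A) - Q(A)|`, over measurable sets `A`. -/
def tv {S : Type*} [MeasurableSpace S] (p q : Measure S) : ℝ :=
  ⨆ A : {A : Set S // MeasurableSet A}, |p.real A.1 - q.real A.1|

/-- `Z 0, Z 1, …` is a time-homogeneous Markov chain under `Pr`, with initial law `ν` and transition
kernel `P`: given `(Z 0, …, Z k)`, the conditional law of `Z (k+1)` is `P (Z k)`. -/
structure IsMarkovChain {Ω S : Type*} [MeasurableSpace Ω] [MeasurableSpace S]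
    (Pr : Measure Ω) (ν : Measure S) (P : Kernel S S) (Z : ℕ → Ω → S) : Prop where
  measurable : ∀ k, Measurable (Z k)
  initial : Pr.map (Z 0) = ν
  step : ∀ k : ℕ,
    Pr.map (fun ω => ((fun i : Fin (k + 1) => Z i ω), Z (k + 1) ω)) =
      (Pr.map (fun ω => fun i : Fin (k + 1) => Z i ω)) ⊗ₘ
        (P.comap (fun h : Fin (k + 1) → S => h (Fin.last k)) (measurable_pi_apply _))

/-- `‖ν P ^ a - π‖_TV`, the distance to `π` of the law of the chain after `a` steps from `ν`. -/
def delta {S : Type*} [MeasurableSpace S] (P : Kernel S S) (π ν : Measure S) (a : ℕ) : ℝ :=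
  tv ((P ^ a) ∘ₘ ν) π

/-- The mixing time `t_mix = min {t : sup_z ‖P ^ t (z, ·) - π‖_TV ≤ 1/4}`.
When there is no such `t` (infinite mixing time) the value is `0`; the mixing time is used only as
the denominator of the exponent in `deviation`, which is then `0`, as it is for `t_mix = ∞`. -/
def mixingTime {S : Type*} [MeasurableSpace S] (P : Kernel S S) (π : Measure S) : ℕ :=
  sInf {t : ℕ | ∀ z : S, tv ((P ^ t) z) π ≤ 1 / 4}

/-- `exp (- 2 m s² / (9 t_mix))`. -/
def deviation {S : Type*} [MeasurableSpace S] (P : Kernel S S) (π : Measure S) (m s : ℝ) : ℝ :=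
  Real.exp (-(2 * m * s ^ 2 / (9 * (mixingTime P π : ℝ))))

/-- The `β`-mixing coefficient of a process: the supremum over `t` of the total variation distance
between the joint law of `(Z 0, …, Z t)` and `(Z (t+a), Z (t+a+1), …)` and the product of their
two laws. -/
def betaCoef {Ω S : Type*} [MeasurableSpace Ω] [MeasurableSpace S]
    (Pr : Measure Ω) (Z : ℕ → Ω → S) (a : ℕ) : ℝ :=
  ⨆ t : ℕ,
    tv ((Pr.map (fun ω => fun i : Fin (t + 1) => Z i ω)).prod
          (Pr.map (fun ω => fun j : ℕ => Z (t + a + j) ω)))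
       (Pr.map (fun ω => ((fun i : Fin (t + 1) => Z i ω), (fun j : ℕ => Z (t + a + j) ω))))

/-- The `α` upper quantile (the `(1 - α)`-quantile) of a law on the real line. -/
def upperQuantile (α : ℝ) (m : Measure ℝ) : ℝ :=
  sInf {x : ℝ | 1 - α ≤ m.real (Iic x)}

/-- The empirical conformal quantile of the scores `s 0, …, s (n-1)`: the `⌈(n+1)(1-α)⌉`-th
smallest of them, which is `+∞` when `⌈(n+1)(1-α)⌉ > n`. -/
def empiricalQuantile (α : ℝ) {n : ℕ} (s : Fin n → ℝ) : EReal :=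
  sInf {x : EReal |
    ⌈((n : ℝ) + 1) * (1 - α)⌉ ≤ ((Finset.univ.filter (fun i : Fin n => (s i : EReal) ≤ x)).card : ℤ)}

/-- The score `|y - g x|` of the point `z = (x, y)` for the regression function `g`. -/
def absResidual {𝒳 : Type*} (g : 𝒳 → ℝ) (z : 𝒳 × ℝ) : ℝ := |z.2 - g z.1|

/-- The oracle quantile given the training data: the `α` upper quantile of `|Y - g X|` for
`(X, Y) ∼ π`. -/
def oracleQuantile {𝒳 : Type*} [MeasurableSpace 𝒳] (α : ℝ) (π : Measure (𝒳 × ℝ)) (g : 𝒳 → ℝ) : ℝ :=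
  upperQuantile α (π.map (absResidual g))

/-- The oracle quantile that averages over the training data: the `α` upper quantile of
`|Y - G X|` for a random regression function `G` and `(X, Y) ∼ π` independent of `G`. -/
def marginalOracleQuantile {𝒳 Ω : Type*} [MeasurableSpace 𝒳] [MeasurableSpace Ω] (α : ℝ)
    (Pr : Measure Ω) (π : Measure (𝒳 × ℝ)) (G : Ω → 𝒳 → ℝ) : ℝ :=
  upperQuantile α ((Pr.prod π).map (fun p => absResidual (G p.1) p.2))

/-- `|a - b| ≤ ε` for an extended real `a` and a real `b` (in particular `a` is finite). -/
def Within (a : EReal) (b ε : ℝ) : Prop :=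
  ((b - ε : ℝ) : EReal) ≤ a ∧ a ≤ ((b + ε : ℝ) : EReal)

end ConformalMarkov

end

open ConformalMarkov

/-!
Let `q` be the `α` upper quantile of the residual `|Y - μ X|` of the true regression function and
`w = u / κ - 2 c - d / κ`. All quantiles in the theorem are compared to `q`, which is
deterministic, so that only the empirical frequencies of two fixed sets have to be controlled. For
one trajectory this yields the bound with `n` for `n - r` and without the `β`-mixing term, from which
the stated one follows.

* On the event that `muHat` is within `c` of `μ`, residuals change by at most `c`. So the conditional
  oracle quantile is within `c` of `q` (`oracleQuantile_le_add`), and the empirical quantile is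
  within `w + c` of `q` as soon as at least `(n + 1)(1 - α)` residuals of `μ` are at most `q + w` and
  fewer than that are at most `q - w` (`within_empiricalQuantile`). The marginal oracle quantile is
  within `c + d / κ` of `q` (`abs_marginalOracleQuantile_sub_le`).
* By the lower bound on the density, `q + w` and `q - w` have distribution function at least
  `1 - α + κ w` and at most `1 - α - κ w`, where `κ w = u - 2 κ c - d`. It remains to bound the
  deviations of two empirical frequencies of the chain (`MarkovProperty.one_sub_deviation_le`).
* For `τ = t_mix` the kernel `P ^ τ` contracts total variation distance by `1 / 2`, so the expected
  total reward of the chain observed every `τ` steps oscillates by at most `1 + 1/2 + 1/4 + ⋯ = 2`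
  (`expectedReward_sub_le`). Hoeffding's lemma, applied once per step, shows that the frequencies
  along a residue class modulo `τ` are sub-Gaussian
  (`MarkovProperty.hasSubgaussianMGF_sum_progression`). Adding the `τ` classes up
  (`MarkovProperty.hasSubgaussianMGF_sum`) gives the exponent `2 n t² / (4 τ)` up to rounding.
* The empirical quantile has rank `⌈(n + 1)(1 - α)⌉` in place of `n (1 - α)`, which costs up to
  `1 - α` observations. Where the bound is not trivial, this and the rounding of `n / τ` are paid
  for by the gap between the constants `4` and `9` (`exponent_le`).
-/

namespace ConformalMarkov

/-! ### Total variation distance -/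

section TotalVariation

variable {S : Type*} [MeasurableSpace S]

lemma abs_real_sub_real_le_one (p q : Measure S) [IsProbabilityMeasure p] [IsProbabilityMeasure q]
    (A : Set S) : |p.real A - q.real A| ≤ 1 := by
  have h1 : p.real A ≤ 1 := measureReal_le_one
  have h2 : q.real A ≤ 1 := measureReal_le_one
  have h3 : 0 ≤ p.real A := measureReal_nonneg
  have h4 : 0 ≤ q.real A := measureReal_nonneg
  rw [abs_le]; constructor <;> linarith

lemma tv_nonneg (p q : Measure S) : 0 ≤ tv p q :=
  Real.iSup_nonneg fun _ => abs_nonneg _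

lemma abs_real_sub_real_le_tv (p q : Measure S) [IsProbabilityMeasure p] [IsProbabilityMeasure q]
    {A : Set S} (hA : MeasurableSet A) : |p.real A - q.real A| ≤ tv p q :=
  le_ciSup (f := fun A : {A : Set S // MeasurableSet A} => |p.real A.1 - q.real A.1|)
    ⟨1, by rintro _ ⟨B, rfl⟩; exact abs_real_sub_real_le_one p q B.1⟩ ⟨A, hA⟩

lemma tv_le_of_forall {p q : Measure S} {b : ℝ}
    (h : ∀ A, MeasurableSet A → |p.real A - q.real A| ≤ b) : tv p q ≤ b :=
  haveI : Nonempty {A : Set S // MeasurableSet A} := ⟨⟨∅, .empty⟩⟩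
  ciSup_le fun A => h A.1 A.2

lemma tv_triangle_right (p q m : Measure S) [IsProbabilityMeasure p] [IsProbabilityMeasure q]
    [IsProbabilityMeasure m] : tv p q ≤ tv p m + tv q m :=
  tv_le_of_forall fun A hA => by
    have h1 := abs_real_sub_real_le_tv p m hA
    have h2 := abs_real_sub_real_le_tv q m hA
    rw [abs_le] at h1 h2 ⊢
    constructor <;> linarith [h1.1, h1.2, h2.1, h2.2]

lemma integrable_of_abs_le {p : Measure S} [IsFiniteMeasure p] {g : S → ℝ} (hg : Measurable g)
    {C : ℝ} (hC : ∀ x, |g x| ≤ C) : Integrable g p :=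
  Integrable.of_bound hg.aestronglyMeasurable C (ae_of_all _ hC)

/-- By the layer cake formula, the difference of the integrals of a `[0, 1]`-valued function is an
average of differences of probabilities of its superlevel sets. -/
lemma abs_integral_sub_integral_le_tv (p q : Measure S) [IsProbabilityMeasure p]
    [IsProbabilityMeasure q] {g : S → ℝ} (hg : Measurable g) (h0 : ∀ x, 0 ≤ g x)
    (h1 : ∀ x, g x ≤ 1) : |∫ x, g x ∂p - ∫ x, g x ∂q| ≤ tv p q := by
  have layer : ∀ m : Measure S, IsProbabilityMeasure m →
      ∫ x, g x ∂m = ∫ t in (0 : ℝ)..1, m.real {a | t ≤ g a} := by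
    intro m _
    have hint : Integrable g m :=
      integrable_of_abs_le hg (C := 1) fun x => by rw [abs_of_nonneg (h0 x)]; exact h1 x
    rw [hint.integral_eq_integral_Ioc_meas_le (M := 1) (ae_of_all _ h0) (ae_of_all _ h1),
      intervalIntegral.integral_of_le zero_le_one]
  have mono : ∀ m : Measure S, IsProbabilityMeasure m →
      IntervalIntegrable (fun t => m.real {a | t ≤ g a}) volume 0 1 := by
    intro m _
    refine Antitone.intervalIntegrable fun s t hst => ?_
    exact measureReal_mono fun a (ha : t ≤ g a) => hst.trans ha
  rw [layer p inferInstance, layer q inferInstance,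
    ← intervalIntegral.integral_sub (mono p inferInstance) (mono q inferInstance)]
  have := intervalIntegral.norm_integral_le_of_norm_le_const (a := (0 : ℝ)) (b := 1) (C := tv p q)
    (f := fun t => p.real {a | t ≤ g a} - q.real {a | t ≤ g a})
    fun t _ => abs_real_sub_real_le_tv p q (measurableSet_le measurable_const hg)
  simpa using this

lemma bddBelow_range_of_forall_sub_le {T : Type*} [Nonempty T] {g : T → ℝ} {b : ℝ}
    (hb : ∀ x y, g x - g y ≤ b) : BddBelow (range g) := by
  obtain ⟨x₀⟩ := ‹Nonempty T›
  exact ⟨g x₀ - b, by rintro _ ⟨y, rfl⟩; linarith [hb x₀ y]⟩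

lemma mem_Icc_of_forall_sub_le {T : Type*} [Nonempty T] {g : T → ℝ} {b : ℝ}
    (hb : ∀ x y, g x - g y ≤ b) (x : T) : g x ∈ Icc (⨅ y, g y) ((⨅ y, g y) + b) := by
  refine ⟨ciInf_le (bddBelow_range_of_forall_sub_le hb) x, ?_⟩
  have : g x - b ≤ ⨅ y, g y := le_ciInf fun y => by linarith [hb x y]
  linarith

lemma integral_sub_integral_le_tv_mul [Nonempty S] (p q : Measure S) [IsProbabilityMeasure p]
    [IsProbabilityMeasure q] {g : S → ℝ} (hg : Measurable g) {b : ℝ} (hb0 : 0 < b)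
    (hb : ∀ x y, g x - g y ≤ b) : ∫ x, g x ∂p - ∫ x, g x ∂q ≤ tv p q * b := by
  set a := ⨅ y, g y
  have hI := mem_Icc_of_forall_sub_le hb
  have hint : ∀ m : Measure S, IsProbabilityMeasure m → Integrable g m := fun m _ =>
    Integrable.of_mem_Icc a (a + b) hg.aemeasurable (ae_of_all _ hI)
  have key := abs_integral_sub_integral_le_tv p q (g := fun x => (g x - a) / b)
    ((hg.sub_const a).div_const b) (fun x => div_nonneg (sub_nonneg.2 (hI x).1) hb0.le)
    (fun x => by rw [div_le_one hb0]; linarith [(hI x).2])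
  have calc1 : ∀ m : Measure S, IsProbabilityMeasure m →
      ∫ x, (g x - a) / b ∂m = (∫ x, g x ∂m - a) / b := by
    intro m hm
    rw [integral_div, integral_sub (hint m hm) (integrable_const _)]
    simp
  rw [calc1 p inferInstance, calc1 q inferInstance, ← sub_div] at key
  have h2 := (le_abs_self _).trans key
  rw [div_le_iff₀ hb0] at h2
  linarith

lemma real_comp_eq_integral (P : Kernel S S) [IsMarkovKernel P] (p : Measure S)
    [IsProbabilityMeasure p] {A : Set S} (hA : MeasurableSet A) :
    (P ∘ₘ p).real A = ∫ x, (P x).real A ∂p := by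
  rw [measureReal_def, Measure.bind_apply hA P.aemeasurable,
    integral_eq_lintegral_of_nonneg_ae (ae_of_all _ fun _ => measureReal_nonneg)
      (P.measurable_coe hA).ennreal_toReal.aestronglyMeasurable]
  congr 1
  refine lintegral_congr fun x => ?_
  rw [measureReal_def, ENNReal.ofReal_toReal (measure_ne_top _ _)]

/-- A Markov kernel does not increase total variation distance. -/
lemma tv_comp_le (P : Kernel S S) [IsMarkovKernel P] (p q : Measure S)
    [IsProbabilityMeasure p] [IsProbabilityMeasure q] : tv (P ∘ₘ p) (P ∘ₘ q) ≤ tv p q :=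
  tv_le_of_forall fun A hA => by
    rw [real_comp_eq_integral P p hA, real_comp_eq_integral P q hA]
    exact abs_integral_sub_integral_le_tv p q (P.measurable_coe hA).ennreal_toReal
      (fun _ => measureReal_nonneg) fun _ => measureReal_le_one

instance isMarkovKernel_pow (P : Kernel S S) [IsMarkovKernel P] (k : ℕ) :
    IsMarkovKernel (P ^ k) := by
  induction k with
  | zero => rw [pow_zero]; exact inferInstanceAs (IsMarkovKernel Kernel.id)
  | succ k ih => rw [pow_succ']; exact inferInstanceAs (IsMarkovKernel (P ∘ₖ (P ^ k)))

lemma pow_succ_comp_measure (P : Kernel S S) (ν : Measure S) (k : ℕ) :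
    (P ^ (k + 1) : Kernel S S) ∘ₘ ν = P ∘ₘ ((P ^ k : Kernel S S) ∘ₘ ν) := by
  rw [pow_succ', Measure.comp_assoc]; rfl

lemma delta_nonneg (P : Kernel S S) (π ν : Measure S) (a : ℕ) : 0 ≤ delta P π ν a := tv_nonneg _ _

lemma delta_antitone (P : Kernel S S) [IsMarkovKernel P] {π : Measure S} [IsProbabilityMeasure π]
    (hπ : P.Invariant π) (ν : Measure S) [IsProbabilityMeasure ν] : Antitone (delta P π ν) := by
  refine antitone_nat_of_succ_le fun k => ?_
  have hπ' : P ∘ₘ π = π := hπ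
  have := tv_comp_le P ((P ^ k : Kernel S S) ∘ₘ ν) π
  rwa [hπ', ← pow_succ_comp_measure] at this

end TotalVariation

/-! ### The Markov property -/

section MarkovProperty

variable {Ω S : Type*} [mΩ : MeasurableSpace Ω] [MeasurableSpace S]

/-- The Markov property of an adapted process `Z` with respect to a filtration `𝓕`, in integrated
form. Unlike `IsMarkovChain` it is stable under shifts of time and says nothing of the initial
law. -/
structure MarkovProperty (Pr : Measure Ω) (P : Kernel S S) (𝓕 : Filtration ℕ mΩ)
    (Z : ℕ → Ω → S) : Prop where
  adapted : ∀ k, Measurable[𝓕 k] (Z k)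
  step : ∀ (k : ℕ) (W : Ω → ENNReal) (φ : S → ENNReal), Measurable[𝓕 k] W → Measurable φ →
    ∫⁻ ω, W ω * φ (Z (k + 1) ω) ∂Pr = ∫⁻ ω, W ω * ∫⁻ y, φ y ∂(P (Z k ω)) ∂Pr

/-- The natural filtration of a process. -/
def historyFiltration (Z : ℕ → Ω → S) (hZ : ∀ k, Measurable (Z k)) : Filtration ℕ mΩ where
  seq k := MeasurableSpace.comap (fun ω => fun i : Fin (k + 1) => Z i ω) inferInstance
  mono' := by
    intro k l hkl
    have : (fun ω => fun i : Fin (k + 1) => Z i ω) =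
        (fun (h : Fin (l + 1) → S) (i : Fin (k + 1)) => h ⟨i, by omega⟩) ∘
          (fun ω => fun i : Fin (l + 1) => Z i ω) := rfl
    simp only
    rw [this, ← MeasurableSpace.comap_comp]
    exact MeasurableSpace.comap_mono
      (measurable_pi_lambda _ fun i => measurable_pi_apply _).comap_le
  le' k := (measurable_pi_lambda _ fun i => hZ _).comap_le

lemma IsMarkovChain.markovProperty {Pr : Measure Ω} [IsProbabilityMeasure Pr] {ν : Measure S}
    {P : Kernel S S} [IsMarkovKernel P] {Z : ℕ → Ω → S} (hZ : IsMarkovChain Pr ν P Z) :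
    MarkovProperty Pr P (historyFiltration Z hZ.measurable) Z where
  adapted k := by
    have h : Z k = (fun h : Fin (k + 1) → S => h (Fin.last k)) ∘
        (fun ω => fun i : Fin (k + 1) => Z i ω) := by rfl
    rw [h]
    exact (measurable_pi_apply _).comp (comap_measurable _)
  step k W φ hW hφ := by
    obtain ⟨H, hH, rfl⟩ := Measurable.exists_eq_measurable_comp hW
    have hist : Measurable (fun ω => fun i : Fin (k + 1) => Z i ω) :=
      measurable_pi_lambda _ fun i => hZ.measurable _
    have hpair : Measurable fun p : (Fin (k + 1) → S) × S => H p.1 * φ p.2 := by fun_prop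
    have e := congrArg (fun m => ∫⁻ p, H p.1 * φ p.2 ∂m) (hZ.step k)
    beta_reduce at e
    rw [lintegral_map hpair (hist.prodMk (hZ.measurable _)),
      Measure.lintegral_compProd hpair] at e
    simp only [Function.comp_apply]
    rw [e]
    have inner : ∀ h : Fin (k + 1) → S,
        ∫⁻ y, H h * φ y ∂((P.comap (fun h : Fin (k + 1) → S => h (Fin.last k))
          (measurable_pi_apply _)) h) = H h * ∫⁻ y, φ y ∂(P (h (Fin.last k))) := fun h => by
      rw [lintegral_const_mul _ hφ, Kernel.comap_apply]
    simp_rw [inner]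
    rw [lintegral_map _ hist]
    · simp
    · exact hH.mul ((hφ.lintegral_kernel (κ := P)).comp (measurable_pi_apply _))

namespace MarkovProperty

variable {Pr : Measure Ω} {P : Kernel S S} {𝓕 : Filtration ℕ mΩ} {Z : ℕ → Ω → S}

lemma measurable (h : MarkovProperty Pr P 𝓕 Z) (k : ℕ) : Measurable (Z k) :=
  (h.adapted k).mono (𝓕.le k) le_rfl

lemma shift (h : MarkovProperty Pr P 𝓕 Z) (N : ℕ) :
    MarkovProperty Pr P
      { seq := fun k => 𝓕 (N + k), mono' := fun _ _ hkl => 𝓕.mono (by omega),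
        le' := fun k => 𝓕.le _ } (fun k => Z (N + k)) where
  adapted k := h.adapted (N + k)
  step k W φ hW hφ := h.step (N + k) W φ hW hφ

lemma step_pow (h : MarkovProperty Pr P 𝓕 Z) (j k : ℕ) {W : Ω → ENNReal}
    {φ : S → ENNReal} (hW : Measurable[𝓕 k] W) (hφ : Measurable φ) :
    ∫⁻ ω, W ω * φ (Z (k + j) ω) ∂Pr =
      ∫⁻ ω, W ω * ∫⁻ y, φ y ∂((P ^ j : Kernel S S) (Z k ω)) ∂Pr := by
  induction j generalizing φ with
  | zero =>
    refine lintegral_congr fun ω => ?_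
    rw [pow_zero, add_zero]
    change _ = W ω * ∫⁻ y, φ y ∂(Kernel.id (Z k ω))
    rw [Kernel.lintegral_id' hφ]
  | succ j ih =>
    rw [← add_assoc, h.step (k + j) W φ (hW.mono (𝓕.mono (by omega)) le_rfl) hφ,
      ih hφ.lintegral_kernel]
    refine lintegral_congr fun ω => ?_
    rw [pow_succ']
    change _ = W ω * ∫⁻ y, φ y ∂((P ∘ₖ (P ^ j)) (Z k ω))
    rw [Kernel.lintegral_comp _ _ _ hφ]

/-- Markov kernels act on laws: the law at time `k + j` is `P ^ j` applied to the law at time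
`k`. -/
lemma map_add (h : MarkovProperty Pr P 𝓕 Z) (k j : ℕ) :
    Pr.map (Z (k + j)) = (P ^ j : Kernel S S) ∘ₘ Pr.map (Z k) := by
  ext A hA
  rw [Measure.map_apply (h.measurable _) hA, Measure.bind_apply hA (P ^ j).aemeasurable,
    lintegral_map ((P ^ j).measurable_coe hA) (h.measurable _)]
  have e := h.step_pow j k (W := 1) (φ := A.indicator 1) measurable_const
    (measurable_one.indicator hA)
  simp only [Pi.one_apply, one_mul, lintegral_indicator_one hA] at e
  rw [← e, ← lintegral_indicator_one (h.measurable _ hA)]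
  rfl

lemma integral_integral_pow (h : MarkovProperty Pr P 𝓕 Z) [IsMarkovKernel P] (k j : ℕ)
    {φ : S → ℝ} (hφ : Measurable φ) (h0 : ∀ x, 0 ≤ φ x) {C : ℝ} (hC : ∀ x, φ x ≤ C) :
    ∫ ω, ∫ y, φ y ∂((P ^ j : Kernel S S) (Z k ω)) ∂Pr = ∫ ω, φ (Z (k + j) ω) ∂Pr := by
  have hφ' : StronglyMeasurable fun x => ∫ y, φ y ∂((P ^ j : Kernel S S) x) :=
    hφ.stronglyMeasurable.integral_kernel
  rw [integral_eq_lintegral_of_nonneg_ae (ae_of_all _ fun _ => integral_nonneg h0)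
      (hφ'.measurable.comp (h.measurable k)).aestronglyMeasurable,
    integral_eq_lintegral_of_nonneg_ae (ae_of_all _ fun _ => h0 _)
      (hφ.comp (h.measurable _)).aestronglyMeasurable]
  have e := h.step_pow j k (W := 1) (φ := fun x => ENNReal.ofReal (φ x)) measurable_const
    hφ.ennreal_ofReal
  simp only [Pi.one_apply, one_mul] at e
  rw [e]
  congr 1
  refine lintegral_congr fun ω => ?_
  refine ofReal_integral_eq_lintegral_ofReal (integrable_of_abs_le hφ (C := C) fun x => ?_)
    (ae_of_all _ h0)
  rw [abs_of_nonneg (h0 x)]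
  exact hC x

end MarkovProperty

end MarkovProperty

lemma IsMarkovChain.map_eq {Ω S : Type*} [MeasurableSpace Ω] [MeasurableSpace S]
    {Pr : Measure Ω} [IsProbabilityMeasure Pr] {ν : Measure S}
    {P : Kernel S S} [IsMarkovKernel P] {Z : ℕ → Ω → S} (hZ : IsMarkovChain Pr ν P Z) (k : ℕ) :
    Pr.map (Z k) = (P ^ k : Kernel S S) ∘ₘ ν := by
  rw [← hZ.initial, ← hZ.markovProperty.map_add 0 k, zero_add]

/-! ### Sub-Gaussian bounds for additive functionals -/

section Concentration

variable {Ω S : Type*} [mΩ : MeasurableSpace Ω] [MeasurableSpace S]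

/-- Hoeffding's lemma for a function of oscillation at most `2`. -/
lemma lintegral_exp_mul_le [Nonempty S] (p : Measure S) [IsProbabilityMeasure p] {h : S → ℝ}
    (hh : Measurable h) (hosc : ∀ x y, h x - h y ≤ 2) (t : ℝ) :
    ∫⁻ x, ENNReal.ofReal (Real.exp (t * h x)) ∂p ≤
      ENNReal.ofReal (Real.exp (t ^ 2 / 2) * Real.exp (t * ∫ x, h x ∂p)) := by
  have hI := mem_Icc_of_forall_sub_le hosc
  have hsub := hasSubgaussianMGF_of_mem_Icc (μ := p) hh.aemeasurable (ae_of_all _ hI)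
  have hc : (‖(⨅ y, h y) + 2 - ⨅ y, h y‖₊ / 2) ^ 2 = 1 := by
    rw [add_sub_cancel_left]; simp
  rw [hc] at hsub
  have hint : Integrable (fun x => Real.exp (t * h x)) p :=
    integrable_exp_mul_of_mem_Icc hh.aemeasurable (ae_of_all _ hI)
  rw [← ofReal_integral_eq_lintegral_ofReal hint (ae_of_all _ fun _ => (Real.exp_pos _).le)]
  refine ENNReal.ofReal_le_ofReal ?_
  have hm := hsub.mgf_le t
  simp only [mgf, mul_sub, Real.exp_sub] at hm
  rw [integral_div, div_le_iff₀ (Real.exp_pos _)] at hm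
  simpa using hm

/-- The expected total reward `g k + g (k + τ) + ⋯` (`m` terms) of a chain with kernel `Q` that sits
at a given point at time `k` and makes one step every `τ` units of time. -/
noncomputable def expectedReward (Q : Kernel S S) (g : ℕ → S → ℝ) (τ : ℕ) : ℕ → ℕ → S → ℝ
  | 0, _ => fun _ => 0
  | m + 1, k => fun x => g k x + ∫ y, expectedReward Q g τ m (k + τ) y ∂(Q x)

section ExpectedReward

variable {Q : Kernel S S} {g : ℕ → S → ℝ} {τ : ℕ}

lemma measurable_expectedReward (hg : ∀ k, Measurable (g k)) (m k : ℕ) :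
    Measurable (expectedReward Q g τ m k) := by
  induction m generalizing k with
  | zero => exact measurable_const
  | succ m ih => exact (hg k).add (ih (k + τ)).stronglyMeasurable.integral_kernel.measurable

lemma expectedReward_nonneg (h0 : ∀ k x, 0 ≤ g k x) (m k : ℕ) (x : S) :
    0 ≤ expectedReward Q g τ m k x := by
  induction m generalizing k x with
  | zero => exact le_rfl
  | succ m ih => exact add_nonneg (h0 k x) (integral_nonneg fun y => ih _ y)

lemma expectedReward_le [IsMarkovKernel Q] (hg : ∀ k, Measurable (g k)) (h0 : ∀ k x, 0 ≤ g k x)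
    (h1 : ∀ k x, g k x ≤ 1) (m k : ℕ) (x : S) : expectedReward Q g τ m k x ≤ m := by
  induction m generalizing k x with
  | zero => simp [expectedReward]
  | succ m ih =>
    have hint : Integrable (expectedReward Q g τ m (k + τ)) (Q x) :=
      integrable_of_abs_le (measurable_expectedReward hg m _) (C := m) fun y => by
        rw [abs_of_nonneg (expectedReward_nonneg h0 m _ y)]; exact ih _ y
    have h := integral_mono hint (integrable_const (m : ℝ)) fun y => ih (k + τ) y
    simp only [integral_const, probReal_univ, smul_eq_mul, one_mul] at h
    have := h1 k x
    simp only [expectedReward, Nat.cast_add, Nat.cast_one]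
    linarith

/-- The expected reward oscillates by at most `1 + 1/2 + 1/4 + ⋯ = 2` if `Q` contracts oscillations
by one half. -/
lemma expectedReward_sub_le [Nonempty S] [IsMarkovKernel Q] (hg : ∀ k, Measurable (g k))
    (h0 : ∀ k x, 0 ≤ g k x) (h1 : ∀ k x, g k x ≤ 1) (hQ : ∀ x y, tv (Q x) (Q y) ≤ 1 / 2)
    (m k : ℕ) (x y : S) : expectedReward Q g τ m k x - expectedReward Q g τ m k y ≤ 2 := by
  induction m generalizing k x y with
  | zero => simp [expectedReward]
  | succ m ih =>
    have h := integral_sub_integral_le_tv_mul (Q x) (Q y)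
      (measurable_expectedReward (Q := Q) (τ := τ) hg m (k + τ)) two_pos fun x y => ih _ x y
    have := h1 k x
    have := h0 k y
    have := hQ x y
    simp only [expectedReward]
    linarith

end ExpectedReward

namespace MarkovProperty

variable {Pr : Measure Ω} {P : Kernel S S} {𝓕 : Filtration ℕ mΩ} {Z : ℕ → Ω → S}
  {g : ℕ → S → ℝ} {τ : ℕ}

/-- The exponential moment of the future rewards is at most that of their conditional expectation,
up to one application of Hoeffding's lemma for each reward. -/
lemma lintegral_exp_sum_le [Nonempty S] (h : MarkovProperty Pr P 𝓕 Z) [IsMarkovKernel P]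
    (hg : ∀ k, Measurable (g k)) (h0 : ∀ k x, 0 ≤ g k x) (h1 : ∀ k x, g k x ≤ 1)
    (hQ : ∀ x y, tv ((P ^ τ : Kernel S S) x) ((P ^ τ : Kernel S S) y) ≤ 1 / 2)
    (t : ℝ) (m k : ℕ) (W : Ω → ENNReal) (hW : Measurable[𝓕 k] W) :
    ∫⁻ ω, W ω * ENNReal.ofReal
        (Real.exp (t * ∑ j ∈ Finset.range m, g (k + (j + 1) * τ) (Z (k + (j + 1) * τ) ω))) ∂Pr ≤
      ENNReal.ofReal (Real.exp (m * (t ^ 2 / 2))) *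
        ∫⁻ ω, W ω * ENNReal.ofReal (Real.exp (t *
          ∫ y, expectedReward (P ^ τ) g τ m (k + τ) y ∂((P ^ τ : Kernel S S) (Z k ω)))) ∂Pr := by
  induction m generalizing k W with
  | zero => simp [expectedReward]
  | succ m ih =>
    set Q : Kernel S S := P ^ τ with hQdef
    set W' : Ω → ENNReal := fun ω =>
      W ω * ENNReal.ofReal (Real.exp (t * g (k + τ) (Z (k + τ) ω))) with hW'def
    have hW' : Measurable[𝓕 (k + τ)] W' := by
      refine (hW.mono (𝓕.mono (by omega)) le_rfl).mul ?_
      exact (Real.measurable_exp.comp (((hg _).comp (h.adapted _)).const_mul t)).ennreal_ofReal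
    have hER := measurable_expectedReward (Q := Q) (τ := τ) hg (m + 1) (k + τ)
    have hφ : Measurable fun x => ENNReal.ofReal
        (Real.exp (t * expectedReward Q g τ (m + 1) (k + τ) x)) :=
      (Real.measurable_exp.comp (hER.const_mul t)).ennreal_ofReal
    calc _ = ∫⁻ ω, W' ω * ENNReal.ofReal (Real.exp (t * ∑ j ∈ Finset.range m,
            g (k + τ + (j + 1) * τ) (Z (k + τ + (j + 1) * τ) ω))) ∂Pr := by
          refine lintegral_congr fun ω => ?_
          rw [Finset.sum_range_succ', hW'def, mul_assoc,
            ← ENNReal.ofReal_mul (Real.exp_pos _).le, ← Real.exp_add, ← mul_add, add_comm]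
          have e : ∀ j, k + (j + 1 + 1) * τ = k + τ + (j + 1) * τ := fun j => by ring
          simp only [e, zero_add, one_mul]
      _ ≤ ENNReal.ofReal (Real.exp (m * (t ^ 2 / 2))) *
          ∫⁻ ω, W' ω * ENNReal.ofReal (Real.exp (t *
            ∫ y, expectedReward Q g τ m (k + τ + τ) y ∂(Q (Z (k + τ) ω)))) ∂Pr :=
          ih (k + τ) W' hW'
      _ = ENNReal.ofReal (Real.exp (m * (t ^ 2 / 2))) *
          ∫⁻ ω, W ω * ENNReal.ofReal
            (Real.exp (t * expectedReward Q g τ (m + 1) (k + τ) (Z (k + τ) ω))) ∂Pr := by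
          congr 1
          refine lintegral_congr fun ω => ?_
          rw [hW'def, mul_assoc, ← ENNReal.ofReal_mul (Real.exp_pos _).le, ← Real.exp_add,
            ← mul_add]
          rfl
      _ = ENNReal.ofReal (Real.exp (m * (t ^ 2 / 2))) *
          ∫⁻ ω, W ω * ∫⁻ y, ENNReal.ofReal
            (Real.exp (t * expectedReward Q g τ (m + 1) (k + τ) y)) ∂(Q (Z k ω)) ∂Pr := by
          rw [h.step_pow τ k hW hφ]
      _ ≤ ENNReal.ofReal (Real.exp (m * (t ^ 2 / 2))) *
          ∫⁻ ω, ENNReal.ofReal (Real.exp (t ^ 2 / 2)) * (W ω * ENNReal.ofReal (Real.exp (t *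
            ∫ y, expectedReward Q g τ (m + 1) (k + τ) y ∂(Q (Z k ω))))) ∂Pr := by
          refine mul_le_mul_right (lintegral_mono fun ω => ?_) _
          refine (mul_le_mul_right (lintegral_exp_mul_le (Q (Z k ω)) hER
            (expectedReward_sub_le hg h0 h1 hQ _ _) t) _).trans_eq ?_
          rw [ENNReal.ofReal_mul (Real.exp_pos _).le, mul_left_comm]
      _ = _ := by
          rw [lintegral_const_mul' _ _ ENNReal.ofReal_ne_top, ← mul_assoc,
            ← ENNReal.ofReal_mul (Real.exp_pos _).le, ← Real.exp_add]
          congr 4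
          push_cast
          ring

lemma integral_expectedReward [IsProbabilityMeasure Pr] (h : MarkovProperty Pr P 𝓕 Z)
    [IsMarkovKernel P] (hg : ∀ k, Measurable (g k)) (h0 : ∀ k x, 0 ≤ g k x)
    (h1 : ∀ k x, g k x ≤ 1) (m k : ℕ) :
    ∫ ω, expectedReward (P ^ τ) g τ m k (Z k ω) ∂Pr =
      ∑ j ∈ Finset.range m, ∫ ω, g (k + j * τ) (Z (k + j * τ) ω) ∂Pr := by
  induction m generalizing k with
  | zero => simp [expectedReward]
  | succ m ih =>
    have hER := measurable_expectedReward (Q := P ^ τ) (τ := τ) hg m (k + τ)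
    have hle := expectedReward_le (Q := P ^ τ) (τ := τ) hg h0 h1 m (k + τ)
    have hnn := expectedReward_nonneg (Q := P ^ τ) (τ := τ) h0 m (k + τ)
    have i1 : Integrable (fun ω => g k (Z k ω)) Pr :=
      integrable_of_abs_le ((hg k).comp (h.measurable k)) (C := 1) fun ω => by
        rw [abs_of_nonneg (h0 _ _)]; exact h1 _ _
    have i2 : Integrable (fun ω => ∫ y, expectedReward (P ^ τ) g τ m (k + τ) y
        ∂((P ^ τ : Kernel S S) (Z k ω))) Pr := by
      refine integrable_of_abs_le (C := m)
        (hER.stronglyMeasurable.integral_kernel.measurable.comp (h.measurable k)) fun ω => ?_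
      rw [abs_of_nonneg (integral_nonneg hnn)]
      have := integral_mono (μ := (P ^ τ : Kernel S S) (Z k ω))
        (integrable_of_abs_le hER (C := m) fun y => by rw [abs_of_nonneg (hnn y)]; exact hle y)
        (integrable_const (m : ℝ)) hle
      simpa using this
    simp only [expectedReward]
    rw [integral_add i1 i2, h.integral_integral_pow k τ hER hnn hle, ih (k + τ),
      Finset.sum_range_succ', add_comm]
    have e : ∀ j, k + (j + 1) * τ = k + τ + j * τ := fun j => by ring
    simp only [e, zero_mul, add_zero]

/-- If `P ^ τ` contracts total variation distance by one half, then a sum of `[0, 1]`-valued rewards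
collected every `τ` steps is as concentrated as a sum of independent variables of range `2`. -/
lemma hasSubgaussianMGF_sum_progression [Nonempty S] [IsProbabilityMeasure Pr]
    (h : MarkovProperty Pr P 𝓕 Z) [IsMarkovKernel P]
    (hg : ∀ k, Measurable (g k)) (h0 : ∀ k x, 0 ≤ g k x) (h1 : ∀ k x, g k x ≤ 1)
    (hQ : ∀ x y, tv ((P ^ τ : Kernel S S) x) ((P ^ τ : Kernel S S) y) ≤ 1 / 2) (m k : ℕ) :
    HasSubgaussianMGF (fun ω => ∑ j ∈ Finset.range m, (g (k + j * τ) (Z (k + j * τ) ω) -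
      ∫ ω', g (k + j * τ) (Z (k + j * τ) ω') ∂Pr)) m Pr := by
  have hgZ : ∀ i, Measurable fun ω => g i (Z i ω) := fun i => (hg i).comp (h.measurable i)
  set X : Ω → ℝ := fun ω => ∑ j ∈ Finset.range m, (g (k + j * τ) (Z (k + j * τ) ω) -
      ∫ ω', g (k + j * τ) (Z (k + j * τ) ω') ∂Pr) with hX
  have hXm : Measurable X := Finset.measurable_fun_sum _ fun j _ => (hgZ _).sub_const _
  have hEbd : ∀ i, |∫ ω', g i (Z i ω') ∂Pr| ≤ 1 := fun i => by
    have := norm_integral_le_of_norm_le_const (μ := Pr) (C := 1)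
      (f := fun ω' => g i (Z i ω')) (ae_of_all _ fun ω => by
        rw [Real.norm_eq_abs, abs_of_nonneg (h0 _ _)]; exact h1 _ _)
    simpa using this
  have hXbd : ∀ ω, X ω ∈ Icc (-(m * 2 : ℝ)) (m * 2) := fun ω => by
    rw [mem_Icc, ← abs_le]
    refine (Finset.abs_sum_le_sum_abs _ _).trans ?_
    refine (Finset.sum_le_card_nsmul _ _ 2 fun j _ => ?_).trans (by simp)
    refine (abs_sub _ _).trans ?_
    have := hEbd (k + j * τ)
    have := h1 (k + j * τ) (Z (k + j * τ) ω)
    rw [abs_of_nonneg (h0 _ _)]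
    linarith
  have hint : ∀ t, Integrable (fun ω => Real.exp (t * X ω)) Pr := fun t =>
    integrable_exp_mul_of_mem_Icc hXm.aemeasurable (ae_of_all _ hXbd)
  refine ⟨hint, fun t => ?_⟩
  set E : ℝ := ∑ j ∈ Finset.range m, ∫ ω', g (k + j * τ) (Z (k + j * τ) ω') ∂Pr with hE
  have key : ∫⁻ ω, ENNReal.ofReal
      (Real.exp (t * ∑ j ∈ Finset.range m, g (k + j * τ) (Z (k + j * τ) ω))) ∂Pr ≤
      ENNReal.ofReal (Real.exp (m * (t ^ 2 / 2)) * Real.exp (t * E)) := by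
    cases m with
    | zero => simp [hE]
    | succ m =>
      have hER := measurable_expectedReward (Q := P ^ τ) (τ := τ) hg (m + 1) k
      have hosc := expectedReward_sub_le (τ := τ) hg h0 h1 hQ (m + 1) k
      have hW : Measurable[𝓕 k] fun ω => ENNReal.ofReal (Real.exp (t * g k (Z k ω))) :=
        (Real.measurable_exp.comp (((hg _).comp (h.adapted _)).const_mul t)).ennreal_ofReal
      have b := h.lintegral_exp_sum_le hg h0 h1 hQ t m k _ hW
      have : IsProbabilityMeasure (Pr.map (Z k)) :=
        Measure.isProbabilityMeasure_map (h.measurable k).aemeasurable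
      have c := lintegral_exp_mul_le (Pr.map (Z k)) hER hosc t
      have hφ : Measurable fun x => ENNReal.ofReal
          (Real.exp (t * expectedReward (P ^ τ) g τ (m + 1) k x)) :=
        (Real.measurable_exp.comp (hER.const_mul t)).ennreal_ofReal
      rw [lintegral_map hφ (h.measurable k), integral_map (h.measurable k).aemeasurable hER.aestronglyMeasurable,
        h.integral_expectedReward hg h0 h1 (m + 1) k, ← hE] at c
      calc _ = ∫⁻ ω, ENNReal.ofReal (Real.exp (t * g k (Z k ω))) * ENNReal.ofReal
              (Real.exp (t * ∑ j ∈ Finset.range m,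
                g (k + (j + 1) * τ) (Z (k + (j + 1) * τ) ω))) ∂Pr := by
            refine lintegral_congr fun ω => ?_
            rw [← ENNReal.ofReal_mul (Real.exp_pos _).le, ← Real.exp_add, ← mul_add,
              Finset.sum_range_succ', add_comm]
            simp only [zero_mul, add_zero]
        _ ≤ _ := b
        _ = ENNReal.ofReal (Real.exp (m * (t ^ 2 / 2))) * ∫⁻ ω, ENNReal.ofReal
              (Real.exp (t * expectedReward (P ^ τ) g τ (m + 1) k (Z k ω))) ∂Pr := by
            congr 1
            refine lintegral_congr fun ω => ?_
            rw [← ENNReal.ofReal_mul (Real.exp_pos _).le, ← Real.exp_add, ← mul_add]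
            rfl
        _ ≤ _ := mul_le_mul_right c _
        _ = _ := by
            rw [← ENNReal.ofReal_mul (Real.exp_pos _).le, ← mul_assoc, ← Real.exp_add]
            congr 3
            push_cast
            ring
  have hsplit : ∀ ω, X ω = ∑ j ∈ Finset.range m, g (k + j * τ) (Z (k + j * τ) ω) - E := fun ω => by
    rw [hX, hE, ← Finset.sum_sub_distrib]
  have i2 : Integrable (fun ω => Real.exp
      (t * ∑ j ∈ Finset.range m, g (k + j * τ) (Z (k + j * τ) ω))) Pr := by
    have := (hint t).mul_const (Real.exp (t * E))
    refine this.congr (ae_of_all _ fun ω => ?_)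
    simp only
    rw [← Real.exp_add, hsplit]
    congr 1
    ring
  rw [← ofReal_integral_eq_lintegral_ofReal i2 (ae_of_all _ fun _ => (Real.exp_pos _).le),
    ENNReal.ofReal_le_ofReal_iff (by positivity)] at key
  simp only [mgf, hsplit, mul_sub, Real.exp_sub]
  rw [integral_div, div_le_iff₀ (Real.exp_pos _)]
  rw [NNReal.coe_natCast, mul_div_assoc]
  exact key

end MarkovProperty

/-- Without independence, sub-Gaussian norms add up. -/
lemma hasSubgaussianMGF_sum_of_forall {Pr : Measure Ω} [IsProbabilityMeasure Pr]
    {X : ℕ → Ω → ℝ} {c : NNReal} (hX : ∀ r, HasSubgaussianMGF (X r) c Pr) (τ : ℕ) :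
    HasSubgaussianMGF (fun ω => ∑ r ∈ Finset.range τ, X r ω) (τ ^ 2 * c) Pr := by
  induction τ with
  | zero => simp
  | succ τ ih =>
    simp only [Finset.sum_range_succ]
    convert ih.add (hX τ) using 1
    rw [NNReal.sqrt_mul, NNReal.sqrt_sq]
    rw [← add_one_mul, mul_pow, NNReal.sq_sqrt]
    push_cast
    ring

lemma sum_range_mul_eq_sum_sum (a : ℕ → ℝ) (m τ : ℕ) :
    ∑ i ∈ Finset.range (m * τ), a i =
      ∑ r ∈ Finset.range τ, ∑ j ∈ Finset.range m, a (r + j * τ) := by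
  induction m with
  | zero => simp
  | succ m ih =>
    rw [add_mul, one_mul, Finset.sum_range_add, ih, ← Finset.sum_add_distrib]
    refine Finset.sum_congr rfl fun r _ => ?_
    rw [Finset.sum_range_succ, add_comm r]

/-- Concentration of an additive functional of a chain, by splitting the times into the residue
classes modulo a `τ` for which `P ^ τ` contracts total variation distance by one half. -/
lemma MarkovProperty.hasSubgaussianMGF_sum [Nonempty S] {Pr : Measure Ω} [IsProbabilityMeasure Pr]
    {P : Kernel S S} [IsMarkovKernel P] {𝓕 : Filtration ℕ mΩ} {Z : ℕ → Ω → S}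
    (h : MarkovProperty Pr P 𝓕 Z) {g : S → ℝ} (hg : Measurable g) (h0 : ∀ x, 0 ≤ g x)
    (h1 : ∀ x, g x ≤ 1) {τ : ℕ} (hτ : 0 < τ)
    (hQ : ∀ x y, tv ((P ^ τ : Kernel S S) x) ((P ^ τ : Kernel S S) y) ≤ 1 / 2) (n : ℕ) :
    HasSubgaussianMGF (fun ω => ∑ i ∈ Finset.range n, (g (Z i ω) - ∫ ω', g (Z i ω') ∂Pr))
      (τ ^ 2 * (n / τ + 1 : ℕ)) Pr := by
  -- Rewards after time `n` are set to zero, so that all residue classes have equal size.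
  set g' : ℕ → S → ℝ := fun k x => if k < n then g x else 0 with hg'
  have hgm : ∀ k, Measurable (g' k) := fun k => by
    by_cases hk : k < n
    · simpa [hg', hk] using hg
    · simp [hg', hk]
  have hg0 : ∀ k x, 0 ≤ g' k x := fun k x => by
    by_cases hk : k < n <;> simp [hg', hk, h0]
  have hg1 : ∀ k x, g' k x ≤ 1 := fun k x => by
    by_cases hk : k < n <;> simp [hg', hk, h1]
  have hs := hasSubgaussianMGF_sum_of_forall (Pr := Pr) (c := ((n / τ + 1 : ℕ) : NNReal))
    (fun r => h.hasSubgaussianMGF_sum_progression hgm hg0 hg1 hQ (n / τ + 1) r) τ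
  convert hs using 2 with ω
  rw [← sum_range_mul_eq_sum_sum (fun i => g' i (Z i ω) - ∫ ω', g' i (Z i ω') ∂Pr)]
  have hn : n ≤ (n / τ + 1) * τ := by
    have := Nat.lt_div_mul_add (a := n) hτ
    rw [add_mul, one_mul]; omega
  rw [← Finset.sum_subset (Finset.range_subset_range.2 hn)]
  · refine Finset.sum_congr rfl fun i hi => ?_
    simp [hg', Finset.mem_range.1 hi]
  · intro i _ hi
    simp [hg', Finset.mem_range.not.1 hi]

end Concentration

/-! ### Empirical frequencies of a Markov chain -/

section Frequencies

variable {Ω S : Type*} [mΩ : MeasurableSpace Ω] [MeasurableSpace S]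

lemma tv_pow_mixingTime_le_half {P : Kernel S S} [IsMarkovKernel P] {π : Measure S}
    [IsProbabilityMeasure π] (h : mixingTime P π ≠ 0) (x y : S) :
    tv ((P ^ mixingTime P π : Kernel S S) x) ((P ^ mixingTime P π : Kernel S S) y) ≤ 1 / 2 := by
  have hm : mixingTime P π ∈ {t : ℕ | ∀ z : S, tv ((P ^ t : Kernel S S) z) π ≤ 1 / 4} :=
    Nat.sInf_mem (Nat.nonempty_of_sInf_eq_succ (Nat.succ_pred_eq_of_ne_zero h).symm)
  have := tv_triangle_right ((P ^ mixingTime P π : Kernel S S) x)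
    ((P ^ mixingTime P π : Kernel S S) y) π
  linarith [hm x, hm y]

/-- The number of the points `Z 0, …, Z (n - 1)` in `B`, as a real number. -/
noncomputable def visits (Z : ℕ → Ω → S) (n : ℕ) (B : Set S) (ω : Ω) : ℝ :=
  ∑ i ∈ Finset.range n, B.indicator 1 (Z i ω)

lemma measurable_visits {Z : ℕ → Ω → S} (hZ : ∀ k, Measurable (Z k)) (n : ℕ) {B : Set S}
    (hB : MeasurableSet B) : Measurable (visits Z n B) :=
  Finset.measurable_fun_sum _ fun i _ => (measurable_one.indicator hB).comp (hZ i)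

lemma MarkovProperty.measure_visits_sub_ge_le [Nonempty S] {Pr : Measure Ω} [IsProbabilityMeasure Pr]
    {P : Kernel S S} [IsMarkovKernel P] {𝓕 : Filtration ℕ mΩ} {Z : ℕ → Ω → S}
    (h : MarkovProperty Pr P 𝓕 Z) {τ : ℕ} (hτ : 0 < τ)
    (hQ : ∀ x y, tv ((P ^ τ : Kernel S S) x) ((P ^ τ : Kernel S S) y) ≤ 1 / 2) (n : ℕ)
    {B : Set S} (hB : MeasurableSet B) {x : ℝ} (hx : 0 ≤ x) :
    Pr.real {ω | x ≤ visits Z n B ω - ∑ i ∈ Finset.range n, (Pr.map (Z i)).real B} ≤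
        Real.exp (-(x ^ 2 / (2 * τ * (n + τ)))) ∧
      Pr.real {ω | x ≤ ∑ i ∈ Finset.range n, (Pr.map (Z i)).real B - visits Z n B ω} ≤
        Real.exp (-(x ^ 2 / (2 * τ * (n + τ)))) := by
  have hsub := h.hasSubgaussianMGF_sum (g := B.indicator 1) (measurable_one.indicator hB)
    (fun x => indicator_nonneg (fun _ _ => zero_le_one) x)
    (fun x => indicator_le_self' (f := fun _ => (1 : ℝ)) (fun _ _ => zero_le_one) x) hτ hQ n
  have hE : ∀ i, ∫ ω, B.indicator (1 : S → ℝ) (Z i ω) ∂Pr = (Pr.map (Z i)).real B := fun i => by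
    rw [map_measureReal_apply (h.measurable i) hB,
      ← integral_indicator_one (h.measurable i hB)]
    rfl
  have hfun : (fun ω => ∑ i ∈ Finset.range n, (B.indicator (1 : S → ℝ) (Z i ω) -
      ∫ ω', B.indicator (1 : S → ℝ) (Z i ω') ∂Pr)) =
      fun ω => visits Z n B ω - ∑ i ∈ Finset.range n, (Pr.map (Z i)).real B := by
    ext ω
    simp only [visits, hE, Finset.sum_sub_distrib]
  rw [hfun] at hsub
  have hτ' : (0 : ℝ) < τ := Nat.cast_pos.2 hτ
  have hexp : Real.exp (-x ^ 2 / (2 * ((τ ^ 2 * (n / τ + 1 : ℕ) : NNReal) : ℝ))) ≤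
      Real.exp (-(x ^ 2 / (2 * τ * (n + τ)))) := by
    rw [Real.exp_le_exp, neg_div, neg_le_neg_iff]
    have hdiv : ((n / τ : ℕ) : ℝ) * τ ≤ n := by exact_mod_cast Nat.div_mul_le_self n τ
    have hdiv0 : (0 : ℝ) ≤ ((n / τ : ℕ) : ℝ) := Nat.cast_nonneg _
    push_cast
    refine div_le_div_of_nonneg_left (sq_nonneg x) (by positivity) ?_
    nlinarith
  refine ⟨(hsub.measure_ge_le hx).trans hexp, ?_⟩
  have := (hsub.neg.measure_ge_le hx).trans hexp
  simpa only [Pi.neg_apply, neg_sub] using this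

/-- The exponent `2 n t² / (9 τ)` is reached even after giving up one observation: subsampling at
step `τ` yields the constant `4` in place of `9`, and the remaining factor pays for the lost
observation as soon as the exponent exceeds `log 2`. -/
lemma exponent_le {n τ t α x : ℝ} (hτ : 1 ≤ τ) (ht : 0 < t) (htα : t ≤ α) (hα : α < 1)
    (hn : 0 ≤ n) (hlog : Real.log 2 ≤ 2 * n * t ^ 2 / (9 * τ)) (hx : n * t - (1 - α) ≤ x) :
    0 ≤ x ∧ 2 * n * t ^ 2 / (9 * τ) ≤ x ^ 2 / (2 * τ * (n + τ)) := by
  have hl := Real.log_two_gt_d9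
  have h1 : 3.1 * τ ≤ n * t ^ 2 := by
    have := hl.le.trans hlog
    rw [le_div_iff₀ (by positivity)] at this
    nlinarith
  have hnt : 0 ≤ n * t := by positivity
  have h2 : 3.1 * (1 - t) ≤ n * t / 4 := by
    have a : 3.1 * (1 - t) ≤ n * t ^ 2 * (1 - t) :=
      mul_le_mul_of_nonneg_right (by linarith) (by linarith)
    have b : n * t * (t * (1 - t)) ≤ n * t * (1 / 4) :=
      mul_le_mul_of_nonneg_left (by nlinarith [sq_nonneg (t - 1 / 2)]) hnt
    linarith
  have h3 : 0.919 * (n * t) ≤ x := by linarith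
  have h4 : 3.1 * τ ≤ n := h1.trans (by nlinarith)
  refine ⟨by linarith, ?_⟩
  rw [div_le_div_iff₀ (by positivity) (by positivity)]
  have h5 : (0.919 * (n * t)) ^ 2 ≤ x ^ 2 := pow_le_pow_left₀ (by positivity) h3 2
  have h6 : n * t ^ 2 * (3.1 * (n + τ)) ≤ n * t ^ 2 * (4.1 * n) :=
    mul_le_mul_of_nonneg_left (by linarith) (by positivity)
  have h7 : 4 * (n * t ^ 2 * (n + τ)) ≤ 9 * x ^ 2 := by nlinarith
  nlinarith

/-- Two-sided control of the numbers of visits to two sets whose stationary probabilities are at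
least `1 - α + s` and at most `1 - α - s`. -/
lemma MarkovProperty.one_sub_deviation_le [Nonempty S] {Pr : Measure Ω} [IsProbabilityMeasure Pr]
    {P : Kernel S S} [IsMarkovKernel P] {𝓕 : Filtration ℕ mΩ} {Z : ℕ → Ω → S}
    (h : MarkovProperty Pr P 𝓕 Z) (π : Measure S) [IsProbabilityMeasure π] (n : ℕ)
    {D s α : ℝ} (hα : α < 1) (hD0 : 0 ≤ D) (hDs : D < s)
    (hD : ∑ i ∈ Finset.range n, tv (Pr.map (Z i)) π ≤ n * D)
    {B C : Set S} (hB : MeasurableSet B) (hC : MeasurableSet C)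
    (hBs : 1 - α + s ≤ π.real B) (hCs : C = ∅ ∨ π.real C ≤ 1 - α - s) :
    1 - 2 * deviation P π n (s - D) ≤
      Pr.real {ω | (n + 1) * (1 - α) ≤ visits Z n B ω ∧ visits Z n C ω < (n + 1) * (1 - α)} := by
  by_cases htriv : 1 / 2 ≤ deviation P π n (s - D)
  · exact (by linarith : _ ≤ (0 : ℝ)).trans measureReal_nonneg
  rw [not_le, deviation] at htriv
  have hτ0 : mixingTime P π ≠ 0 := fun h0 => by
    rw [h0] at htriv; norm_num at htriv
  have hQ := tv_pow_mixingTime_le_half hτ0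
  set τ := mixingTime P π
  have hτ1 : (1 : ℝ) ≤ τ := by exact_mod_cast Nat.one_le_iff_ne_zero.2 hτ0
  have hlog : Real.log 2 ≤ 2 * n * (s - D) ^ 2 / (9 * τ) := by
    have := (Real.log_lt_log (Real.exp_pos _) htriv).le
    rw [Real.log_exp, one_div, Real.log_inv] at this
    linarith
  have hsα : s ≤ α := by
    have : π.real B ≤ 1 := measureReal_le_one
    linarith
  have hn : (0 : ℝ) ≤ n := Nat.cast_nonneg n
  have hclose : ∀ A, MeasurableSet A →
      |∑ i ∈ Finset.range n, (Pr.map (Z i)).real A - n * π.real A| ≤ n * D := fun A hA => by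
    have e : ∑ i ∈ Finset.range n, (Pr.map (Z i)).real A - n * π.real A =
        ∑ i ∈ Finset.range n, ((Pr.map (Z i)).real A - π.real A) := by
      simp [Finset.sum_sub_distrib]
    rw [e]
    refine (Finset.abs_sum_le_sum_abs _ _).trans ((Finset.sum_le_sum fun i _ => ?_).trans hD)
    have : IsProbabilityMeasure (Pr.map (Z i)) :=
      Measure.isProbabilityMeasure_map (h.measurable i).aemeasurable
    exact abs_real_sub_real_le_tv _ _ hA
  have hdev : ∀ x : ℝ, n * (s - D) - (1 - α) ≤ x →
      0 ≤ x ∧ Real.exp (-(x ^ 2 / (2 * τ * (n + τ)))) ≤ deviation P π n (s - D) := fun x hx => by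
    have := exponent_le hτ1 (by linarith : 0 < s - D) (by linarith) hα hn hlog hx
    exact ⟨this.1, Real.exp_le_exp.2 (neg_le_neg this.2)⟩
  have hupper : Pr.real {ω | visits Z n B ω < (n + 1) * (1 - α)} ≤ deviation P π n (s - D) := by
    obtain ⟨hx, hle⟩ := hdev _ le_rfl
    refine le_trans ?_ (((h.measure_visits_sub_ge_le (Nat.pos_of_ne_zero hτ0) hQ n hB hx).2).trans
      hle)
    refine measureReal_mono fun ω (hω : visits Z n B ω < _) => ?_
    have := (abs_le.1 (hclose B hB)).1
    have := mul_le_mul_of_nonneg_left hBs hn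
    simp only [mem_ofPred_eq]
    linarith
  have hlower : Pr.real {ω | (n + 1) * (1 - α) ≤ visits Z n C ω} ≤ deviation P π n (s - D) := by
    rcases hCs with rfl | hCs
    · have : {ω | (n + 1) * (1 - α) ≤ visits Z n ∅ ω} = ∅ := by
        ext ω
        have : 0 < ((n : ℝ) + 1) * (1 - α) := mul_pos (by positivity) (by linarith)
        simpa [visits] using this
      rw [this, measureReal_empty]
      exact (Real.exp_pos _).le
    · obtain ⟨hx, hle⟩ := hdev (n * (s - D)) (by linarith)
      refine le_trans ?_ (((h.measure_visits_sub_ge_le (Nat.pos_of_ne_zero hτ0) hQ n hC hx).1).trans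
        hle)
      refine measureReal_mono fun ω (hω : _ ≤ visits Z n C ω) => ?_
      have := (abs_le.1 (hclose C hC)).2
      have := mul_le_mul_of_nonneg_left hCs hn
      simp only [mem_ofPred_eq]
      linarith
  have hmB : MeasurableSet {ω | (n + 1) * (1 - α) ≤ visits Z n B ω} :=
    measurableSet_le measurable_const (measurable_visits h.measurable n hB)
  have hmC : MeasurableSet {ω | visits Z n C ω < (n + 1) * (1 - α)} :=
    measurableSet_lt (measurable_visits h.measurable n hC) measurable_const
  have hcompl := probReal_compl_eq_one_sub (μ := Pr) (hmB.inter hmC)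
  rw [compl_inter] at hcompl
  have hunion := measureReal_union_le (μ := Pr) {ω | (n + 1) * (1 - α) ≤ visits Z n B ω}ᶜ
    {ω | visits Z n C ω < (n + 1) * (1 - α)}ᶜ
  have e1 : {ω | (n + 1) * (1 - α) ≤ visits Z n B ω}ᶜ = {ω | visits Z n B ω < (n + 1) * (1 - α)} :=
    by ext; simp
  have e2 : {ω | visits Z n C ω < (n + 1) * (1 - α)}ᶜ = {ω | (n + 1) * (1 - α) ≤ visits Z n C ω} :=
    by ext; simp
  rw [hcompl, e1, e2] at hunion
  rw [ofPred_and]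
  linarith

end Frequencies

/-! ### Quantiles of laws on the line -/

section Quantiles

variable {m : Measure ℝ} [IsProbabilityMeasure m] {α κ ρ : ℝ} {f : ℝ → ℝ}

lemma nonempty_upperQuantile_set (hα : 0 < α) : {x : ℝ | 1 - α ≤ m.real (Iic x)}.Nonempty := by
  obtain ⟨x, hx⟩ := ((tendsto_cdf_atTop m).eventually_const_lt (by linarith : 1 - α < 1)).exists
  rw [cdf_eq_real] at hx
  exact ⟨x, hx.le⟩

lemma upperQuantile_le (hα : α < 1) {x : ℝ} (hx : 1 - α ≤ m.real (Iic x)) :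
    upperQuantile α m ≤ x := by
  refine csInf_le ?_ hx
  obtain ⟨b, hb⟩ := ((tendsto_cdf_atBot m).eventually_lt_const (by linarith : 0 < 1 - α)).exists
  refine ⟨b, fun y (hy : 1 - α ≤ m.real (Iic y)) => ?_⟩
  rw [← cdf_eq_real] at hy
  exact ((monotone_cdf m).reflect_lt (hb.trans_le hy)).le

lemma le_upperQuantile (hα : 0 < α) {y : ℝ} (h : ∀ x, 1 - α ≤ m.real (Iic x) → y ≤ x) :
    y ≤ upperQuantile α m :=
  le_csInf (nonempty_upperQuantile_set hα) h

lemma le_real_Iic_upperQuantile (hα : 0 < α) : 1 - α ≤ m.real (Iic (upperQuantile α m)) := by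
  rw [← cdf_eq_real]
  refine ge_of_tendsto (((cdf m).right_continuous (upperQuantile α m)).mono Ioi_subset_Ici_self) ?_
  filter_upwards [self_mem_nhdsWithin] with x hx
  obtain ⟨y, hy, hyx⟩ := exists_lt_of_csInf_lt (nonempty_upperQuantile_set hα) hx
  rw [cdf_eq_real]
  exact le_trans hy (measureReal_mono (Iic_subset_Iic.2 hyx.le))

lemma real_Iic_upperQuantile_le [NullSingletonClass m] (hα : α < 1) :
    m.real (Iic (upperQuantile α m)) ≤ 1 - α := by
  rw [← cdf_eq_real]
  set q := upperQuantile α m with hq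
  have hs := (cdf m).measure_singleton q
  rw [measure_cdf, measure_singleton, eq_comm, ENNReal.ofReal_eq_zero, sub_nonpos] at hs
  refine hs.trans (le_of_tendsto ((monotone_cdf m).tendsto_leftLim q) ?_)
  filter_upwards [self_mem_nhdsWithin] with x (hx : x < q)
  rw [cdf_eq_real]
  exact (lt_of_not_ge fun h => hx.not_ge (upperQuantile_le hα h)).le

lemma mul_sub_le_real_Iic_sub (hdens : m = volume.withDensity fun x => ENNReal.ofReal (f x))
    (hκ : 0 ≤ κ) {a b : ℝ} (hab : a ≤ b) (hf : ∀ x ∈ Icc a b, κ ≤ f x) :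
    κ * (b - a) ≤ m.real (Iic b) - m.real (Iic a) := by
  rw [← measureReal_sdiff (Iic_subset_Iic.2 hab) measurableSet_Iic, Iic_sdiff_Iic]
  have h : ENNReal.ofReal (κ * (b - a)) ≤ m (Ioc a b) := by
    rw [hdens, withDensity_apply _ measurableSet_Ioc, ENNReal.ofReal_mul hκ, ← Real.volume_Ioc,
      ← setLIntegral_const]
    exact setLIntegral_mono' measurableSet_Ioc fun x hx =>
      ENNReal.ofReal_le_ofReal (hf x (Ioc_subset_Icc_self hx))
  exact (ENNReal.ofReal_le_iff_le_toReal (measure_ne_top _ _)).1 h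

lemma le_real_Iic_add (hdens : m = volume.withDensity fun x => ENNReal.ofReal (f x))
    (hκ : 0 ≤ κ) (hα : 0 < α) (hq : 0 ≤ upperQuantile α m)
    (hf : ∀ x, 0 ≤ x → |x - upperQuantile α m| ≤ ρ → κ ≤ f x) {y : ℝ} (hy : 0 ≤ y) (hyρ : y ≤ ρ) :
    1 - α + κ * y ≤ m.real (Iic (upperQuantile α m + y)) := by
  have h := mul_sub_le_real_Iic_sub hdens hκ (le_add_of_nonneg_right hy) fun x hx =>
    hf x (hq.trans hx.1) (by rw [abs_of_nonneg (sub_nonneg.2 hx.1)]; linarith [hx.2])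
  have := le_real_Iic_upperQuantile (m := m) hα
  rw [add_sub_cancel_left] at h
  linarith

lemma real_Iic_sub_le [NullSingletonClass m] (hdens : m = volume.withDensity fun x => ENNReal.ofReal (f x))
    (hκ : 0 ≤ κ) (hα : α < 1)
    (hf : ∀ x, 0 ≤ x → |x - upperQuantile α m| ≤ ρ → κ ≤ f x) {y : ℝ} (hy : 0 ≤ y) (hyρ : y ≤ ρ)
    (hyq : y ≤ upperQuantile α m) :
    m.real (Iic (upperQuantile α m - y)) ≤ 1 - α - κ * y := by
  have h := mul_sub_le_real_Iic_sub hdens hκ (sub_le_self _ hy) fun x hx =>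
    hf x ((sub_nonneg.2 hyq).trans hx.1) (by
      rw [abs_of_nonpos (sub_nonpos.2 hx.2)]; linarith [hx.1])
  have := real_Iic_upperQuantile_le (m := m) hα
  rw [sub_sub_cancel] at h
  linarith

end Quantiles

/-! ### Empirical conformal quantiles -/

section Empirical

variable {n : ℕ} {α : ℝ} {s : Fin n → ℝ}

lemma empiricalQuantile_le {b : ℝ}
    (h : (n + 1) * (1 - α) ≤ ((Finset.univ.filter fun i => s i ≤ b).card : ℝ)) :
    empiricalQuantile α s ≤ (b : EReal) := by
  refine sInf_le ?_
  simp only [mem_ofPred_eq, EReal.coe_le_coe_iff]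
  exact Int.ceil_le.2 (by exact_mod_cast h)

lemma le_empiricalQuantile {a : ℝ}
    (h : ((Finset.univ.filter fun i => s i < a).card : ℝ) < (n + 1) * (1 - α)) :
    (a : EReal) ≤ empiricalQuantile α s := by
  refine le_sInf fun x hx => ?_
  by_contra! hxa
  have hx' := Int.ceil_le.1 hx
  have hcard : (Finset.univ.filter fun i => (s i : EReal) ≤ x).card ≤
      (Finset.univ.filter fun i => s i < a).card :=
    Finset.card_le_card fun i hi => by
      simp only [Finset.mem_filter, Finset.mem_univ, true_and] at hi ⊢
      exact EReal.coe_lt_coe_iff.1 (hi.trans_lt hxa)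
  have : ((Finset.univ.filter fun i => (s i : EReal) ≤ x).card : ℝ) ≤
      (Finset.univ.filter fun i => s i < a).card := by exact_mod_cast hcard
  push_cast at hx'
  linarith

end Empirical

open Classical in
lemma visits_eq_card {Ω S : Type*} (Z : ℕ → Ω → S) (n : ℕ) (B : Set S) (ω : Ω) :
    visits Z n B ω = ((Finset.univ.filter fun i : Fin n => Z i ω ∈ B).card : ℝ) := by
  rw [visits, Finset.sum_range, Finset.card_filter]
  push_cast
  refine Finset.sum_congr rfl fun i _ => ?_
  by_cases h : Z i ω ∈ B <;> simp [h]

/-! ### Residuals of nearby regression functions -/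

lemma absResidual_nonneg {𝒳 : Type*} (g : 𝒳 → ℝ) (z : 𝒳 × ℝ) : 0 ≤ absResidual g z := abs_nonneg _

lemma absResidual_le_add {𝒳 : Type*} {g μ : 𝒳 → ℝ} {c : ℝ} (h : ∀ x, |g x - μ x| ≤ c) (z : 𝒳 × ℝ) :
    absResidual g z ≤ absResidual μ z + c := by
  have h1 := h z.1
  have h2 := abs_sub_le z.2 (μ z.1) (g z.1)
  rw [abs_sub_comm (μ z.1)] at h2
  simp only [absResidual]
  linarith

section Residuals

variable {𝒳 Ω : Type*} [MeasurableSpace 𝒳] [MeasurableSpace Ω]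

lemma measurable_absResidual {g : 𝒳 → ℝ} (hg : Measurable g) : Measurable (absResidual g) :=
  (measurable_snd.sub (hg.comp measurable_fst)).abs

lemma real_map_absResidual {π : Measure (𝒳 × ℝ)} {g : 𝒳 → ℝ} (hg : Measurable g) (x : ℝ) :
    (π.map (absResidual g)).real (Iic x) = π.real {z | absResidual g z ≤ x} :=
  map_measureReal_apply (measurable_absResidual hg) measurableSet_Iic

lemma real_map_absResidual_of_neg {π : Measure (𝒳 × ℝ)} {g : 𝒳 → ℝ} (hg : Measurable g) {x : ℝ}
    (hx : x < 0) : (π.map (absResidual g)).real (Iic x) = 0 := by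
  rw [real_map_absResidual hg]
  convert measureReal_empty
  ext z
  simpa using hx.trans_le (absResidual_nonneg g z)

/-- If two regression functions are within `c` of each other, then so are their residuals, and the
distribution functions of the residuals are ordered after a shift by `c`. -/
lemma real_map_absResidual_le {π : Measure (𝒳 × ℝ)} [IsFiniteMeasure π] {g μ : 𝒳 → ℝ}
    (hg : Measurable g) (hμ : Measurable μ) {c : ℝ} (h : ∀ x, |g x - μ x| ≤ c) (x : ℝ) :
    (π.map (absResidual g)).real (Iic x) ≤ (π.map (absResidual μ)).real (Iic (x + c)) := by
  rw [real_map_absResidual hg, real_map_absResidual hμ]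
  refine measureReal_mono fun z (hz : absResidual g z ≤ x) => ?_
  exact (absResidual_le_add (fun y => (abs_sub_comm _ _).trans_le (h y)) z).trans (by linarith)

variable {π : Measure (𝒳 × ℝ)} [IsProbabilityMeasure π] {g μ : 𝒳 → ℝ} {α c : ℝ}

lemma isProbabilityMeasure_map_absResidual (hg : Measurable g) :
    IsProbabilityMeasure (π.map (absResidual g)) :=
  Measure.isProbabilityMeasure_map (measurable_absResidual hg).aemeasurable

lemma oracleQuantile_nonneg (hα0 : 0 < α) (hα1 : α < 1) (hμ : Measurable μ) :
    0 ≤ oracleQuantile α π μ := by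
  have := isProbabilityMeasure_map_absResidual (π := π) hμ
  refine le_upperQuantile hα0 fun x hx => ?_
  by_contra! h
  rw [real_map_absResidual_of_neg hμ h] at hx
  linarith

lemma oracleQuantile_le_add (hα0 : 0 < α) (hα1 : α < 1) (hg : Measurable g) (hμ : Measurable μ)
    (h : ∀ x, |g x - μ x| ≤ c) : oracleQuantile α π g ≤ oracleQuantile α π μ + c := by
  have := isProbabilityMeasure_map_absResidual (π := π) hμ
  have := isProbabilityMeasure_map_absResidual (π := π) hg
  refine upperQuantile_le hα1 ?_
  exact (le_real_Iic_upperQuantile hα0).trans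
    (real_map_absResidual_le hμ hg (fun x => (abs_sub_comm _ _).trans_le (h x)) _)

/-- The distribution function of the residual of a random regression function is the mean of the
conditional ones. -/
lemma real_map_prod_absResidual {Pr : Measure Ω} [IsProbabilityMeasure Pr] {G : Ω → 𝒳 → ℝ}
    (hG : Measurable (Function.uncurry G)) (x : ℝ) :
    Measurable (fun ω => (π.map (absResidual (G ω))).real (Iic x)) ∧
    ((Pr.prod π).map (fun p => absResidual (G p.1) p.2)).real (Iic x) =
      ∫ ω, (π.map (absResidual (G ω))).real (Iic x) ∂Pr := by
  have hF : Measurable fun p : Ω × (𝒳 × ℝ) => absResidual (G p.1) p.2 :=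
    (measurable_snd.snd.sub (hG.comp (measurable_fst.prodMk measurable_snd.fst))).abs
  have hGω : ∀ ω, Measurable (G ω) := fun ω => hG.comp measurable_prodMk_left
  have hset : MeasurableSet {p : Ω × (𝒳 × ℝ) | absResidual (G p.1) p.2 ≤ x} :=
    measurableSet_le hF measurable_const
  have e : ∀ ω, (π.map (absResidual (G ω))).real (Iic x) =
      (π (Prod.mk ω ⁻¹' {p : Ω × (𝒳 × ℝ) | absResidual (G p.1) p.2 ≤ x})).toReal := fun ω =>
    real_map_absResidual (hGω ω) x
  have hm := measurable_measure_prodMk_left (ν := π) hset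
  simp_rw [e]
  refine ⟨hm.ennreal_toReal, ?_⟩
  rw [map_measureReal_apply hF measurableSet_Iic, measureReal_def,
    integral_toReal hm.aemeasurable (ae_of_all _ fun _ => measure_lt_top _ _),
    ← Measure.prod_apply hset]
  rfl

/-- A mean is at least `(1 - d) v` if the variable is at least `v` on a set, measurable or not, of
outer measure `1 - d`. -/
lemma mul_le_integral_of_le_on {Pr : Measure Ω} [IsProbabilityMeasure Pr] {φ : Ω → ℝ}
    (hφ : Measurable φ) (h0 : ∀ ω, 0 ≤ φ ω) (h1 : ∀ ω, φ ω ≤ 1) {G : Set Ω} {d v : ℝ}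
    (hG : 1 - d ≤ Pr.real G) (hv : 0 ≤ v) (h : ∀ ω ∈ G, v ≤ φ ω) :
    (1 - d) * v ≤ ∫ ω, φ ω ∂Pr := by
  have hint : Integrable φ Pr := integrable_of_abs_le hφ (C := 1) fun ω => by
    rw [abs_of_nonneg (h0 ω)]; exact h1 ω
  have hM := mul_meas_ge_le_integral_of_nonneg (ae_of_all _ h0) hint v
  have hmono : Pr.real G ≤ Pr.real {ω | v ≤ φ ω} := measureReal_mono h
  nlinarith

section Marginal

variable {Pr : Measure Ω} [IsProbabilityMeasure Pr] {G : Ω → 𝒳 → ℝ} {d κ ρ : ℝ} {f : ℝ → ℝ}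

/-- Averaging over the training data moves the oracle quantile by at most `c + d / κ`: by `c` on the
event that the regression function is accurate, and by `d / κ` because the complementary event
perturbs the distribution function by at most `d`. -/
lemma abs_marginalOracleQuantile_sub_le (hG : Measurable (Function.uncurry G)) (hμ : Measurable μ)
    (hα0 : 0 < α) (hα1 : α < 1) (hc : 0 ≤ c) (hd : 0 ≤ d)
    (hgood : 1 - d ≤ Pr.real {ω | ∀ x, |G ω x - μ x| ≤ c})
    (hdens : π.map (absResidual μ) = volume.withDensity fun x => ENNReal.ofReal (f x))
    (hκ : 0 < κ) (hf : ∀ x, 0 ≤ x → |x - oracleQuantile α π μ| ≤ ρ → κ ≤ f x) (hρ : d / κ < ρ) :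
    |marginalOracleQuantile α Pr π G - oracleQuantile α π μ| ≤ c + d / κ := by
  set m := π.map (absResidual μ) with hm
  have hmp : IsProbabilityMeasure m := isProbabilityMeasure_map_absResidual hμ
  have hatom : NullSingletonClass m := by rw [hdens]; infer_instance
  have hq0 : 0 ≤ oracleQuantile α π μ := oracleQuantile_nonneg hα0 hα1 hμ
  set q := oracleQuantile α π μ with hq
  have hF : Measurable fun p : Ω × (𝒳 × ℝ) => absResidual (G p.1) p.2 :=
    (measurable_snd.snd.sub (hG.comp (measurable_fst.prodMk measurable_snd.fst))).abs
  have hGω : ∀ ω, Measurable (G ω) := fun ω => hG.comp measurable_prodMk_left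
  have hMp : IsProbabilityMeasure ((Pr.prod π).map fun p => absResidual (G p.1) p.2) :=
    Measure.isProbabilityMeasure_map hF.aemeasurable
  have hb0 : ∀ x ω, 0 ≤ (π.map (absResidual (G ω))).real (Iic x) := fun _ _ => measureReal_nonneg
  have hb1 : ∀ x ω, (π.map (absResidual (G ω))).real (Iic x) ≤ 1 := fun x ω =>
    haveI := isProbabilityMeasure_map_absResidual (π := π) (hGω ω)
    measureReal_le_one
  have hdκ : 0 ≤ d / κ := by positivity
  have hκd : κ * (d / κ) = d := mul_div_cancel₀ d hκ.ne'
  rw [abs_le]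
  constructor
  · suffices q - (c + d / κ) ≤ marginalOracleQuantile α Pr π G by linarith
    refine le_upperQuantile hα0 fun x hx => ?_
    obtain ⟨hmeas, hint⟩ := real_map_prod_absResidual (Pr := Pr) (π := π) hG x
    rw [hint] at hx
    by_contra! hlt
    rcases lt_or_ge x 0 with hx0 | hx0
    · simp only [real_map_absResidual_of_neg (hGω _) hx0, integral_zero] at hx
      linarith
    -- A point of the window around `q` in which the density is bounded below, to the right of
    -- `x + c` and to the left of `q - d / κ`.
    set y := min ρ (q - (x + c)) with hy
    have hyd : d / κ < y := lt_min hρ (by linarith)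
    have hyq : y ≤ q := (min_le_right _ _).trans (by linarith)
    have hFy := real_Iic_sub_le (m := m) hdens hκ.le hα1 hf (hdκ.trans hyd.le)
      (min_le_left _ _) hyq
    have hκy : d < κ * y := by rw [← hκd]; exact mul_lt_mul_of_pos_left hyd hκ
    have hxy : m.real (Iic (x + c)) ≤ m.real (Iic (q - y)) :=
      measureReal_mono (Iic_subset_Iic.2 (by linarith [min_le_right ρ (q - (x + c))]))
    have hFx : m.real (Iic (x + c)) ≤ 1 := measureReal_le_one
    have hFx0 : 0 ≤ m.real (Iic (x + c)) := measureReal_nonneg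
    have key := mul_le_integral_of_le_on (Pr := Pr) (hmeas.const_sub 1)
      (fun ω => sub_nonneg.2 (hb1 x ω)) (fun ω => sub_le_self _ (hb0 x ω)) hgood
      (sub_nonneg.2 hFx)
      (fun ω hω => sub_le_sub_left (real_map_absResidual_le (hGω ω) hμ hω x) 1)
    rw [integral_sub (integrable_const _) (integrable_of_abs_le hmeas (C := 1) fun ω => by
      rw [abs_of_nonneg (hb0 x ω)]; exact hb1 x ω)] at key
    simp only [integral_const, probReal_univ, smul_eq_mul, mul_one] at key
    have : 0 ≤ d * m.real (Iic (x + c)) := mul_nonneg hd hFx0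
    change m.real (Iic (q - y)) ≤ 1 - α - κ * y at hFy
    nlinarith
  · suffices marginalOracleQuantile α Pr π G ≤ q + d / κ + c by linarith
    refine upperQuantile_le hα1 ?_
    obtain ⟨hmeas, hint⟩ := real_map_prod_absResidual (Pr := Pr) (π := π) hG (q + d / κ + c)
    rw [hint]
    have hFq : 1 - α + κ * (d / κ) ≤ m.real (Iic (q + d / κ)) :=
      le_real_Iic_add (m := m) hdens hκ.le hα0 hq0 hf hdκ hρ.le
    rw [hκd] at hFq
    have hF1 : m.real (Iic (q + d / κ)) ≤ 1 := measureReal_le_one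
    have key := mul_le_integral_of_le_on (Pr := Pr) hmeas (hb0 _) (hb1 _) hgood
      measureReal_nonneg
      (fun ω hω => real_map_absResidual_le (π := π) hμ (hGω ω)
        (fun x => (abs_sub_comm _ _).trans_le (hω x)) (q + d / κ))
    change (1 - d) * m.real (Iic (q + d / κ)) ≤ _ at key
    nlinarith

end Marginal

end Residuals

/-! ### Conformal quantiles under Markov dependence -/

lemma within_of_abs_le {a : EReal} {b c ε η : ℝ} (h : Within a b ε) (hbc : |c - b| ≤ η - ε) :
    Within a c η := by
  rw [abs_le] at hbc
  exact ⟨(EReal.coe_le_coe_iff.2 (by linarith)).trans h.1,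
    h.2.trans (EReal.coe_le_coe_iff.2 (by linarith))⟩

open Classical in
/-- The empirical quantile of the residuals of `g` is controlled by the numbers of visits to
sublevel sets of the residual of a function `μ` within `c` of `g`. -/
lemma within_empiricalQuantile {𝒳 Ω : Type*} {V : ℕ → Ω → 𝒳 × ℝ} {n : ℕ} {ω : Ω} {α q w c : ℝ}
    {g μ : 𝒳 → ℝ} (h : ∀ x, |g x - μ x| ≤ c)
    (hU : (n + 1) * (1 - α) ≤ visits V n {z | absResidual μ z ≤ q + w} ω)
    (hL : visits V n {z | absResidual μ z ≤ q - w} ω < (n + 1) * (1 - α)) :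
    Within (empiricalQuantile α fun i : Fin n => absResidual g (V i ω)) q (w + c) := by
  have h' : ∀ x, |μ x - g x| ≤ c := fun x => (abs_sub_comm _ _).trans_le (h x)
  rw [visits_eq_card] at hU hL
  constructor
  · refine le_empiricalQuantile (lt_of_le_of_lt ?_ hL)
    refine Nat.cast_le.2 (Finset.card_le_card fun i hi => ?_)
    simp only [Finset.mem_filter, Finset.mem_univ, true_and, mem_ofPred_eq] at hi ⊢
    linarith [absResidual_le_add h' (V i ω)]
  · refine empiricalQuantile_le (hU.trans ?_)
    refine Nat.cast_le.2 (Finset.card_le_card fun i hi => ?_)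
    simp only [Finset.mem_filter, Finset.mem_univ, true_and, mem_ofPred_eq] at hi ⊢
    linarith [absResidual_le_add h (V i ω)]

section Conformal

variable {𝒳 Ω : Type*} [MeasurableSpace 𝒳] [mΩ : MeasurableSpace Ω]

/-- A set of outer measure at least `1 - d` meets a measurable set in outer measure at least the
probability of the latter minus `d`. -/
lemma measureReal_sub_le_inter {Pr : Measure Ω} [IsProbabilityMeasure Pr] {G A : Set Ω} {d : ℝ}
    (hA : MeasurableSet A) (hG : 1 - d ≤ Pr.real G) : Pr.real A - d ≤ Pr.real (G ∩ A) := by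
  have h1 := measureReal_inter_add_sdiff (μ := Pr) (s := G) hA
  have h2 : Pr.real (G \ A) ≤ Pr.real Aᶜ := measureReal_mono fun x hx => hx.2
  rw [probReal_compl_eq_one_sub hA] at h2
  linarith

/-- The concentration of the empirical conformal quantile around both oracle quantiles, for
calibration data whose laws are on average within `D` of the stationary one. On the event that `G`
is accurate, both are compared to the quantile of the residual of the deterministic function
`μ`, so `G` and the calibration data may depend on each other in any way. -/
lemma MarkovProperty.conformal_bound {Pr : Measure Ω} [IsProbabilityMeasure Pr]
    {P : Kernel (𝒳 × ℝ) (𝒳 × ℝ)} [IsMarkovKernel P] {π : Measure (𝒳 × ℝ)} [IsProbabilityMeasure π]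
    {𝓕 : Filtration ℕ mΩ} {V : ℕ → Ω → 𝒳 × ℝ} (hV : MarkovProperty Pr P 𝓕 V) {n : ℕ}
    {G : Ω → 𝒳 → ℝ} (hG : Measurable (Function.uncurry G)) {μ : 𝒳 → ℝ} (hμ : Measurable μ)
    {c d α κ u D : ℝ} (hgood : 1 - d ≤ Pr.real {ω | ∀ x, |G ω x - μ x| ≤ c})
    (hα0 : 0 < α) (hα1 : α < 1) {f : ℝ → ℝ}
    (hdens : π.map (absResidual μ) = volume.withDensity fun x => ENNReal.ofReal (f x))
    (hκ : 0 < κ) (hf : ∀ x, 0 ≤ x → |x - oracleQuantile α π μ| ≤ u / κ - 2 * c → κ ≤ f x)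
    (hD0 : 0 ≤ D) (hDu : D < u - 2 * κ * c - d)
    (hD : ∑ i ∈ Finset.range n, tv (Pr.map (V i)) π ≤ n * D) :
    1 - 2 * deviation P π n (u - 2 * κ * c - d - D) - d ≤
      Pr.real {ω |
        Within (empiricalQuantile α (fun i : Fin n => absResidual (G ω) (V i ω)))
          (oracleQuantile α π (G ω)) (u / κ) ∧
        Within (empiricalQuantile α (fun i : Fin n => absResidual (G ω) (V i ω)))
          (marginalOracleQuantile α Pr π G) (u / κ)} := by
  have hd : 0 ≤ d := by
    have : Pr.real {ω | ∀ x, |G ω x - μ x| ≤ c} ≤ 1 := measureReal_le_one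
    linarith
  have hdev : 0 ≤ deviation P π n (u - 2 * κ * c - d - D) := (Real.exp_pos _).le
  rcases eq_empty_or_nonempty {ω | ∀ x, |G ω x - μ x| ≤ c} with hempty | ⟨ω₀, hω₀⟩
  · rw [hempty, measureReal_empty] at hgood
    exact (by linarith : _ ≤ (0 : ℝ)).trans measureReal_nonneg
  have hne : Nonempty (𝒳 × ℝ) := ⟨V 0 ω₀⟩
  have hc : 0 ≤ c := (abs_nonneg _).trans (hω₀ (V 0 ω₀).1)
  have hmp : IsProbabilityMeasure (π.map (absResidual μ)) :=
    isProbabilityMeasure_map_absResidual hμ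
  have hatom : NullSingletonClass (π.map (absResidual μ)) := by rw [hdens]; infer_instance
  have hq0 : 0 ≤ oracleQuantile α π μ := oracleQuantile_nonneg hα0 hα1 hμ
  set w := u / κ - 2 * c - d / κ with hw
  have hκw : κ * w = u - 2 * κ * c - d := by rw [hw]; field_simp
  have hw0 : 0 < w := pos_of_mul_pos_right (a := κ) (by linarith) hκ.le
  have hdκ : 0 ≤ d / κ := by positivity
  have hmarg := abs_marginalOracleQuantile_sub_le hG hμ hα0 hα1 hc hd hgood hdens hκ hf
    (by linarith)
  have hBm : ∀ a, MeasurableSet {z | absResidual μ z ≤ a} := fun a =>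
    measurableSet_le (measurable_absResidual hμ) measurable_const
  set q := oracleQuantile α π μ with hq
  have hB : 1 - α + κ * w ≤ π.real {z | absResidual μ z ≤ q + w} := by
    rw [← real_map_absResidual hμ]
    exact le_real_Iic_add hdens hκ.le hα0 hq0 hf hw0.le (by linarith)
  have hC : {z | absResidual μ z ≤ q - w} = ∅ ∨
      π.real {z | absResidual μ z ≤ q - w} ≤ 1 - α - κ * w := by
    rcases lt_or_ge q w with hqw | hqw
    · left
      ext z
      simpa using (sub_neg.2 hqw).trans_le (absResidual_nonneg μ z)
    · right
      rw [← real_map_absResidual hμ]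
      exact real_Iic_sub_le hdens hκ.le hα1 hf hw0.le (by linarith) hqw
  have hmain := hV.one_sub_deviation_le π n hα1 hD0 (hκw ▸ hDu) hD (hBm _) (hBm _) hB hC
  rw [hκw] at hmain
  have hmeas : MeasurableSet {ω |
      (n + 1) * (1 - α) ≤ visits V n {z | absResidual μ z ≤ q + w} ω ∧
        visits V n {z | absResidual μ z ≤ q - w} ω < (n + 1) * (1 - α)} :=
    (measurableSet_le measurable_const (measurable_visits hV.measurable n (hBm _))).inter
      (measurableSet_lt (measurable_visits hV.measurable n (hBm _)) measurable_const)
  refine (sub_le_sub_right hmain d).trans ((measureReal_sub_le_inter hmeas hgood).trans ?_)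
  refine measureReal_mono fun ω hω => ?_
  obtain ⟨hωG, hU, hL⟩ := hω
  have hWi := within_empiricalQuantile hωG hU hL
  have hGω : Measurable (G ω) := hG.comp measurable_prodMk_left
  constructor
  · refine within_of_abs_le hWi (abs_le.2 ?_)
    have h1 := oracleQuantile_le_add (π := π) hα0 hα1 hGω hμ hωG
    have h2 := oracleQuantile_le_add (π := π) hα0 hα1 hμ hGω
      fun x => (abs_sub_comm _ _).trans_le (hωG x)
    constructor <;> linarith
  · exact within_of_abs_le hWi (hmarg.trans (by linarith))

lemma betaCoef_nonneg {S : Type*} [MeasurableSpace S] (Pr : Measure Ω) (Z : ℕ → Ω → S) (a : ℕ) :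
    0 ≤ betaCoef Pr Z a :=
  Real.iSup_nonneg fun _ => tv_nonneg _ _

lemma deviation_le_deviation {S : Type*} [MeasurableSpace S] (P : Kernel S S) (π : Measure S)
    {m m' s s' : ℝ} (hm : 0 ≤ m) (hmm : m ≤ m') (hs : 0 ≤ s) (hss : s ≤ s') :
    deviation P π m' s' ≤ deviation P π m s := by
  refine Real.exp_le_exp.2 (neg_le_neg ?_)
  have : 0 ≤ m' := hm.trans hmm
  gcongr

end Conformal

end ConformalMarkov

theorem mainTheorem2
    {𝒳 Ω : Type*} [MeasurableSpace 𝒳] [MeasurableSpace Ω]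
    (Pr : Measure Ω) [IsProbabilityMeasure Pr]
    -- the transition kernel of the chain of pairs `(X, Y)` and its stationary distribution
    (P : Kernel (𝒳 × ℝ) (𝒳 × ℝ)) [IsMarkovKernel P]
    (π : Measure (𝒳 × ℝ)) [IsProbabilityMeasure π] (hπ : P.Invariant π)
    -- the chain: the first `N` points are the training data
    (ν₀ : Measure (𝒳 × ℝ)) [IsProbabilityMeasure ν₀]
    (Z : ℕ → Ω → 𝒳 × ℝ) (hZ : IsMarkovChain Pr ν₀ P Z)
    (N n : ℕ)
    -- the regression algorithm and the regressor fitted on the training data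
    (fit : (Fin N → 𝒳 × ℝ) → 𝒳 → ℝ) (hfit : Measurable (Function.uncurry fit))
    (muHat : Ω → 𝒳 → ℝ) (hmuHat : ∀ ω, muHat ω = fit (fun i => Z i ω))
    (μ : 𝒳 → ℝ) (hμ : Measurable μ)
    (c d : ℝ) (hsup : 1 - d ≤ Pr.real {ω | ∀ x, |muHat ω x - μ x| ≤ c})
    (α : ℝ) (hα0 : 0 < α) (hα1 : α < 1)
    -- the density of `|Y - μ X|` under `π` is at least `κ` near its `α` upper quantile
    (f : ℝ → ℝ) (hf : Measurable f) (hf0 : ∀ x, 0 ≤ f x)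
    (hdens : π.map (absResidual μ) =
      volume.withDensity (fun x => ENNReal.ofReal (f x)))
    (κ : ℝ) (hκ : 0 < κ) (𝒩 : Set ℝ)
    (h𝒩 : 𝒩 ∈ 𝓝 (oracleQuantile α π μ)) (hfκ : ∀ x ∈ 𝒩, κ ≤ f x)
    (u : ℝ)
    (hu : ∀ x, 0 ≤ x → |x - oracleQuantile α π μ| ≤ u / κ - 2 * c → x ∈ 𝒩) :
    -- one trajectory: the calibration data are the `n` points that follow the training data
    (∀ (r : ℕ) (u' : ℝ), 1 ≤ r → r ≤ n →
      u' = u - 2 * κ * c - d - (1 + r * α) / (n + 1) →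
      delta P π ν₀ N < u' →
      1 - 2 * deviation P π ((n : ℝ) - r) (u' - delta P π ν₀ N)
          - d - betaCoef Pr Z r ≤
        Pr.real {ω |
          Within
            (empiricalQuantile α
              (fun i : Fin n => absResidual (muHat ω) (Z (N + i) ω)))
            (oracleQuantile α π (muHat ω)) (u / κ) ∧
          Within
            (empiricalQuantile α
              (fun i : Fin n => absResidual (muHat ω) (Z (N + i) ω)))
            (marginalOracleQuantile α Pr π muHat) (u / κ)}) ∧
    -- restart: the calibration data come from an independent chain with initial law `ν₁`
    (∀ (ν₁ : Measure (𝒳 × ℝ)) (V : ℕ → Ω → 𝒳 × ℝ), IsProbabilityMeasure ν₁ →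
      IsMarkovChain Pr ν₁ P V →
      IndepFun (fun ω => fun i : Fin N => Z i ω) (fun ω => fun j : ℕ => V j ω) Pr →
      ∀ u' δ₁ : ℝ,
      u' = u - 2 * κ * c - d →
      δ₁ = (∑ i ∈ Finset.range n, delta P π ν₁ i) / n →
      δ₁ < u' →
      1 - 2 * deviation P π n (u' - δ₁) - d ≤
        Pr.real {ω |
          Within
            (empiricalQuantile α
              (fun i : Fin n => absResidual (muHat ω) (V i ω)))
            (oracleQuantile α π (muHat ω)) (u / κ) ∧
          Within
            (empiricalQuantile α
              (fun i : Fin n => absResidual (muHat ω) (V i ω)))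
            (marginalOracleQuantile α Pr π muHat) (u / κ)}) := by
  have hG : Measurable (Function.uncurry muHat) := by
    have e : Function.uncurry muHat = fun p : Ω × 𝒳 =>
        Function.uncurry fit ((fun i : Fin N => Z i p.1), p.2) := by
      ext ⟨ω, x⟩
      simp [Function.uncurry, hmuHat]
    rw [e]
    exact hfit.comp ((measurable_pi_lambda _ fun i =>
      (hZ.measurable _).comp measurable_fst).prodMk measurable_snd)
  have hf' : ∀ x, 0 ≤ x → |x - oracleQuantile α π μ| ≤ u / κ - 2 * c → κ ≤ f x :=
    fun x hx hxq => hfκ x (hu x hx hxq)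
  constructor
  · intro r u' _ hrn hu' hδ
    have hδ0 := delta_nonneg P π ν₀ N
    have hr : (r : ℝ) ≤ n := Nat.cast_le.2 hrn
    have hslack : 0 ≤ (1 + r * α) / ((n : ℝ) + 1) := by positivity
    have hD : ∑ i ∈ Finset.range n, tv (Pr.map (Z (N + i))) π ≤ n * delta P π ν₀ N := by
      refine (Finset.sum_le_card_nsmul _ _ (delta P π ν₀ N) fun i _ => ?_).trans (by simp)
      rw [hZ.map_eq]
      exact delta_antitone P hπ ν₀ (Nat.le_add_right N i)
    have hmain := (hZ.markovProperty.shift N).conformal_bound hG hμ hsup hα0 hα1 hdens hκ hf' hδ0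
      (by linarith) hD
    refine le_trans ?_ hmain
    have hβ := betaCoef_nonneg Pr Z r
    have hdev := deviation_le_deviation P π (m := (n : ℝ) - r) (m' := n)
      (s := u' - delta P π ν₀ N) (s' := u - 2 * κ * c - d - delta P π ν₀ N)
      (by linarith) (by linarith [Nat.cast_nonneg (α := ℝ) r]) (by linarith) (by linarith)
    linarith
  · intro ν₁ V hν₁ hV _ u' δ₁ hu' hδ₁ hδu
    subst hu'
    have hδ0 : 0 ≤ δ₁ := by
      rw [hδ₁]
      exact div_nonneg (Finset.sum_nonneg fun i _ => delta_nonneg P π ν₁ i) (Nat.cast_nonneg n)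
    refine hV.markovProperty.conformal_bound hG hμ hsup hα0 hα1 hdens hκ hf' hδ0 hδu ?_
    rcases Nat.eq_zero_or_pos n with rfl | hn
    · simp
    rw [hδ₁, mul_div_cancel₀ _ (Nat.cast_pos.2 hn).ne']
    exact (Finset.sum_congr rfl fun i _ => by rw [hV.map_eq]; rfl).le
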